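/- Theorem 1.2. For a real number $x$ let $\|x\|$ denote the distance from $x$ to the nearest integer. Let $b \ge 2$ be an integer. For a real number $\xi$, let $v_b(\xi)$ be the supremum (in $[-\infty,+\infty]$) of the real numbers $v$ for which the inequality $\|b^n \xi\| < (b^n)^{-v}$ has infinitely many solutions in positive integers $n$, and let $\hat v_b(\xi)$ be the supremum (in $[-\infty,+\infty]$) of the real numbers $v$ for which, for every sufficiently large integer $N$, the inequality $\|b^n \xi\| < (b^N)^{-v}$ has a solution in integers $n$ with $1 \le n \le N$. Let $\theta$ and $\hat v$ be positive real numbers with $\hat v < 1$. If $\theta < 1/(1-\hat v)$, then the set $$\{\xi \in \mathbf{R} : \hat v_b(\xi) \ge \hat v\} \cap \{\xi \in \mathbf{R} : v_b(\xi) = \theta \hat v\}$$ is empty. Otherwise, $$\dim\bigl(\{\xi \in \mathbf{R} : \hat v_b(\xi) = \hat v\} \cap \{\xi \in \mathbf{R} : v_b(\xi) = \theta \hat v\}\bigr) = \frac{\theta - 1 - \theta \hat v}{(1 + \theta \hat v)(\theta - 1)},$$ where $\dim$ denotes the Hausdorff dimension. Furthermore, $$\dim \{\xi \in \mathbf{R}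 : \hat v_b(\xi) = 1\} = 0.$$ -/

import Mathlib

/-- The distance from a real number to its nearest integer. -/
noncomputable def distNearestInt (x : ℝ) : ℝ := |x - round x|

/-- The exponent `v_b(ξ)`, a supremum in the extended reals: the real numbers `v` for which
`‖b ^ n ξ‖ < (b ^ n) ^ (-v)` has infinitely many solutions in positive integers `n`. -/
noncomputable def expV (b : ℕ) (ξ : ℝ) : EReal :=
  sSup ((fun v : ℝ => (v : EReal)) ''
    {v : ℝ | {n : ℕ | 1 ≤ n ∧ distNearestInt ((b : ℝ) ^ n * ξ) < ((b : ℝ) ^ n) ^ (-v)}.Infinite})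

/-- The uniform exponent `v̂_b(ξ)`, a supremum in the extended reals: the real numbers `v` for
which, for every sufficiently large integer `N`, the inequality
`‖b ^ n ξ‖ < (b ^ N) ^ (-v)` has a solution `n` with `1 ≤ n ≤ N`. -/
noncomputable def expVHat (b : ℕ) (ξ : ℝ) : EReal :=
  sSup ((fun v : ℝ => (v : EReal)) ''
    {v : ℝ | ∃ N₀ : ℕ, ∀ N : ℕ, N₀ ≤ N →
      ∃ n : ℕ, 1 ≤ n ∧ n ≤ N ∧ distNearestInt ((b : ℝ) ^ n * ξ) < ((b : ℝ) ^ N) ^ (-v)})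

open Set Filter Topology MeasureTheory
open scoped ENNReal NNReal

/-! Put `a n = ‖b^n ξ‖` and follow its records, the indices where `a` is smaller than ever before.
Multiplication by `b` scales the distance to the nearest integer until it passes 1/2, so consecutive
records `m < n` satisfy `b^(n-m) * a m > 1/2`. A uniform exponent above `v` forces `a m <
b^(-v(n-1))`. Together these give `m ≲ (1-v) n`, hence `v_b ≥ v̂/(1-v̂)` (`div_one_sub_le_expV`).
This yields the emptiness claim; it also gives `v_b = ∞` when `v̂ = 1`, and a direct covering shows
that `v_b = ∞` holds only on a set of dimension 0.

Upper bound. The value `v_b = θ v̂` adds `n ≲ θ m`. Once the integer nearest to `b^m ξ` is known,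
about `b^(n-m-vn)` integers can be nearest to `b^n ξ`. Recursively there are at most a constant
times `b^(αn)` candidates at a record `n`, as soon as `(1-α)(1-1/θ) < v̂`
(`RecordChain.exists_finset`). Infinitely many records approximate `ξ` within `b^(-(1+w)n)` for any
`w < θ v̂`, so covering gives dimension at most `α/(1+w)`; the critical `α` and `w` give the
formula.

Lower bound. Prescribe base-`b` digits: blocks of zeros starting near `A θ^k`, of length `v = θ v̂`
times their start, and marker digits in two residue classes mod `h` that prevent any other long run
of `0` or `b-1`. All other digits are free. Reading off the free digits is a Hölder map onto `[0,1]`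
whose exponent is a lower bound for their density (`ofReal_le_dimH_range_ofDigits_insertDigits`).
The proportion outside the blocks is lowest at block ends, about `(1 - v/(θ-1))/(1+v)`, which is the
claimed value; the markers cost `2/h`, and `h → ∞`. -/

/-! ### Distance to the nearest integer -/

theorem distNearestInt_nonneg (x : ℝ) : 0 ≤ distNearestInt x := abs_nonneg _

theorem distNearestInt_le (x : ℝ) (z : ℤ) : distNearestInt x ≤ |x - z| := round_le x z

theorem distNearestInt_eq_of_abs_le_half {x : ℝ} {z : ℤ} (h : |x - z| ≤ 1 / 2) :
    distNearestInt x = |x - z| := by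
  refine le_antisymm (distNearestInt_le x z) ?_
  by_cases hz : round x = z
  · simp [distNearestInt, hz]
  · have h1 : (1 : ℝ) ≤ |(round x : ℝ) - z| := by
      have : (1 : ℤ) ≤ |round x - z| := Int.one_le_abs (sub_ne_zero.mpr hz)
      exact_mod_cast this
    have h2 : |(round x : ℝ) - z| ≤ |x - round x| + |x - z| := by
      rw [abs_sub_comm x (round x : ℝ)]
      exact abs_sub_le _ _ _
    unfold distNearestInt
    linarith

/-- The integer `c * round x` is still a nearest one to `c * x` while the scaled error is at most
1/2. -/
theorem distNearestInt_natCast_mul {c : ℕ} {x : ℝ} (h : c * distNearestInt x ≤ 1 / 2) :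
    distNearestInt (c * x) = c * distNearestInt x := by
  have h1 : |(c : ℝ) * x - ((c * round x : ℤ) : ℝ)| = c * distNearestInt x := by
    push_cast
    rw [← mul_sub, abs_mul, Nat.abs_cast, distNearestInt]
  rw [← h1]
  exact distNearestInt_eq_of_abs_le_half (h1 ▸ h)

theorem distNearestInt_add_intCast (x : ℝ) (z : ℤ) :
    distNearestInt (x + z) = distNearestInt x := by
  simp [distNearestInt]

theorem natCast_pow_rpow_neg (b n : ℕ) (v : ℝ) :
    ((b : ℝ) ^ n) ^ (-v) = (b : ℝ) ^ (-(v * n)) := by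
  rw [← Real.rpow_natCast, ← Real.rpow_mul (Nat.cast_nonneg b)]
  congr 1
  ring

/-! ### The two exponents as asymptotic inequalities -/

section Exponents

variable {b : ℕ} {ξ v : ℝ}

theorem infinite_of_lt_expV (hb : 2 ≤ b) (h : (v : EReal) < expV b ξ) :
    {n : ℕ | 1 ≤ n ∧ distNearestInt ((b : ℝ) ^ n * ξ) < (b : ℝ) ^ (-(v * n))}.Infinite := by
  obtain ⟨_, ⟨w, hw, rfl⟩, hvw⟩ := lt_sSup_iff.mp h
  refine Set.Infinite.mono ?_ hw
  rintro n ⟨hn, hlt⟩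
  refine ⟨hn, hlt.trans_le ?_⟩
  rw [natCast_pow_rpow_neg]
  have : v < w := EReal.coe_lt_coe_iff.mp hvw
  have hb1 : (1 : ℝ) ≤ b := by exact_mod_cast (by omega : 1 ≤ b)
  gcongr

theorem eventually_of_lt_expVHat (hb : 2 ≤ b) (h : (v : EReal) < expVHat b ξ) :
    ∃ N₀ : ℕ, ∀ N : ℕ, N₀ ≤ N → ∃ n : ℕ, 1 ≤ n ∧ n ≤ N ∧
      distNearestInt ((b : ℝ) ^ n * ξ) < (b : ℝ) ^ (-(v * N)) := by
  obtain ⟨_, ⟨w, ⟨N₀, hw⟩, rfl⟩, hvw⟩ := lt_sSup_iff.mp h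
  refine ⟨N₀, fun N hN => ?_⟩
  obtain ⟨n, h1, h2, hlt⟩ := hw N hN
  refine ⟨n, h1, h2, hlt.trans_le ?_⟩
  rw [natCast_pow_rpow_neg]
  have : v < w := EReal.coe_lt_coe_iff.mp hvw
  have hb1 : (1 : ℝ) ≤ b := by exact_mod_cast (by omega : 1 ≤ b)
  gcongr

theorem le_expV_of_infinite
    (h : {n : ℕ | 1 ≤ n ∧ distNearestInt ((b : ℝ) ^ n * ξ) < (b : ℝ) ^ (-(v * n))}.Infinite) :
    (v : EReal) ≤ expV b ξ :=
  le_sSup ⟨v, by simpa only [natCast_pow_rpow_neg, mem_ofPred_eq] using h, rfl⟩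

theorem le_expVHat_of_eventually
    (h : ∃ N₀ : ℕ, ∀ N : ℕ, N₀ ≤ N → ∃ n : ℕ, 1 ≤ n ∧ n ≤ N ∧
      distNearestInt ((b : ℝ) ^ n * ξ) < (b : ℝ) ^ (-(v * N))) :
    (v : EReal) ≤ expVHat b ξ :=
  le_sSup ⟨v, by simpa only [natCast_pow_rpow_neg, mem_ofPred_eq] using h, rfl⟩

theorem eventually_le_of_expV_lt (h : expV b ξ < (v : EReal)) :
    ∃ n₀ : ℕ, ∀ n : ℕ, n₀ ≤ n →
      (b : ℝ) ^ (-(v * n)) ≤ distNearestInt ((b : ℝ) ^ n * ξ) := by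
  have hfin : ¬ {n : ℕ | 1 ≤ n ∧
      distNearestInt ((b : ℝ) ^ n * ξ) < (b : ℝ) ^ (-(v * n))}.Infinite :=
    fun hi => h.not_ge (le_expV_of_infinite hi)
  obtain ⟨B, hB⟩ := (not_infinite.mp hfin).bddAbove
  refine ⟨B + 1, fun n hn => ?_⟩
  by_contra! hlt
  have := hB ⟨by omega, hlt⟩
  omega

theorem expV_le_of_forall_eventually (hb : 2 ≤ b)
    (h : ∀ w > v, ∃ n₀ : ℕ, ∀ n : ℕ, n₀ ≤ n →
      (b : ℝ) ^ (-(w * n)) ≤ distNearestInt ((b : ℝ) ^ n * ξ)) :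
    expV b ξ ≤ v := by
  refine le_of_not_gt fun hlt => ?_
  obtain ⟨w, hvw, hw⟩ := EReal.lt_iff_exists_real_btwn.mp hlt
  obtain ⟨n₀, hn₀⟩ := h w (by exact_mod_cast hvw)
  obtain ⟨n, ⟨-, hn⟩, hgt⟩ := (infinite_of_lt_expV hb hw).exists_gt n₀
  exact absurd hn (hn₀ n hgt.le).not_gt

theorem expVHat_le_of_forall_frequently (hb : 2 ≤ b)
    (h : ∀ w > v, ∀ N₀ : ℕ, ∃ N ≥ N₀, ∀ n : ℕ, 1 ≤ n → n ≤ N →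
      (b : ℝ) ^ (-(w * N)) ≤ distNearestInt ((b : ℝ) ^ n * ξ)) :
    expVHat b ξ ≤ v := by
  refine le_of_not_gt fun hlt => ?_
  obtain ⟨w, hvw, hw⟩ := EReal.lt_iff_exists_real_btwn.mp hlt
  obtain ⟨N₀, hN₀⟩ := eventually_of_lt_expVHat hb hw
  obtain ⟨N, hN, hNle⟩ := h w (by exact_mod_cast hvw) N₀
  obtain ⟨n, h1, h2, hn⟩ := hN₀ N hN
  exact absurd hn (hNle n h1 h2).not_gt

theorem le_expV_of_forall_infinite
    (h : ∀ w < v, {n : ℕ | 1 ≤ n ∧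
      distNearestInt ((b : ℝ) ^ n * ξ) < (b : ℝ) ^ (-(w * n))}.Infinite) :
    (v : EReal) ≤ expV b ξ := by
  refine le_of_forall_lt fun c hc => ?_
  obtain ⟨w, hcw, hw⟩ := EReal.lt_iff_exists_real_btwn.mp hc
  exact hcw.trans_le (le_expV_of_infinite (h w (by exact_mod_cast hw)))

theorem le_expVHat_of_forall_eventually
    (h : ∀ w < v, ∃ N₀ : ℕ, ∀ N : ℕ, N₀ ≤ N → ∃ n : ℕ, 1 ≤ n ∧ n ≤ N ∧
      distNearestInt ((b : ℝ) ^ n * ξ) < (b : ℝ) ^ (-(w * N))) :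
    (v : EReal) ≤ expVHat b ξ := by
  refine le_of_forall_lt fun c hc => ?_
  obtain ⟨w, hcw, hw⟩ := EReal.lt_iff_exists_real_btwn.mp hc
  exact hcw.trans_le (le_expVHat_of_eventually (h w (by exact_mod_cast hw)))

/-- Once the orbit hits an integer it stays on integers. This disposes of vanishing distances, so
that the record arguments may assume positivity. -/
theorem expV_eq_top_of_distNearestInt_eq_zero (hb : 2 ≤ b) {n : ℕ}
    (h : distNearestInt ((b : ℝ) ^ n * ξ) = 0) : expV b ξ = ⊤ := by
  refine EReal.eq_top_iff_forall_lt _ |>.mpr fun y => ?_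
  refine lt_of_lt_of_le (by exact_mod_cast lt_add_one y) (le_expV_of_infinite (v := y + 1) ?_)
  refine infinite_of_forall_exists_gt fun N => ⟨max n N + 1, ⟨by omega, ?_⟩, by omega⟩
  have hb0 : (0 : ℝ) < b := by exact_mod_cast (by omega : 0 < b)
  obtain ⟨j, hj⟩ : ∃ j, max n N + 1 = j + n := ⟨max n N + 1 - n, by omega⟩
  have h0 : distNearestInt ((b : ℝ) ^ (max n N + 1) * ξ) = 0 := by
    have := distNearestInt_natCast_mul (c := b ^ j) (x := (b : ℝ) ^ n * ξ) (by rw [h]; norm_num)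
    rw [h, mul_zero, Nat.cast_pow, ← mul_assoc, ← pow_add, ← hj] at this
    exact this
  rw [h0]
  positivity

end Exponents

/-! ### Records of the orbit and the inequality between the exponents -/

/-- The distance from `b ^ n * ξ` to the nearest integer. -/
noncomputable abbrev orbitDist (b : ℕ) (ξ : ℝ) (n : ℕ) : ℝ := distNearestInt ((b : ℝ) ^ n * ξ)

/-- `n ≥ 1` is a record of `a` if `a n` is strictly smaller than all the values `a j` with
`1 ≤ j < n`. -/
def IsRecord (a : ℕ → ℝ) (n : ℕ) : Prop := 1 ≤ n ∧ ∀ j, 1 ≤ j → j < n → a n < a j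

theorem exists_isRecord_le (a : ℕ → ℝ) {N : ℕ} (hN : 1 ≤ N) :
    ∃ n ≤ N, IsRecord a n ∧ ∀ j, 1 ≤ j → j ≤ N → a n ≤ a j := by
  induction N, hN using Nat.le_induction with
  | base =>
    refine ⟨1, le_rfl, ⟨le_rfl, fun j h1 h2 => by omega⟩, fun j h1 h2 => ?_⟩
    rw [le_antisymm h2 h1]
  | succ N hN ih =>
    obtain ⟨n, hnN, hn, hmin⟩ := ih
    rcases lt_or_ge (a (N + 1)) (a n) with h | h
    · refine ⟨N + 1, le_rfl, ⟨by omega, fun j h1 h2 => h.trans_le (hmin j h1 (by omega))⟩, ?_⟩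
      intro j h1 h2
      rcases h2.lt_or_eq with h3 | rfl
      · exact h.le.trans (hmin j h1 (by omega))
      · exact le_rfl
    · refine ⟨n, by omega, hn, fun j h1 h2 => ?_⟩
      rcases h2.lt_or_eq with h3 | rfl
      · exact hmin j h1 (by omega)
      · exact h

theorem exists_isRecord_gt {a : ℕ → ℝ} (hpos : ∀ n, 0 < a n)
    (hinf : ∀ ε > 0, ∃ n, 1 ≤ n ∧ a n < ε) (B : ℕ) : ∃ n > B, IsRecord a n := by
  obtain ⟨n, -, -, hmin⟩ := exists_isRecord_le a (N := B + 1) (by omega)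
  obtain ⟨j, hj, hlt⟩ := hinf (a n) (hpos n)
  obtain ⟨m, -, hm, hmj⟩ := exists_isRecord_le a hj
  refine ⟨m, ?_, hm⟩
  by_contra! hmB
  linarith [hmin m hm.1 (by omega), hmj j hj le_rfl]

theorem tendsto_rpow_neg_mul_atTop {b : ℕ} (hb : 2 ≤ b) {w : ℝ} (hw : 0 < w) :
    Tendsto (fun n : ℕ => (b : ℝ) ^ (-(w * n))) atTop (𝓝 0) := by
  have hb1 : (1 : ℝ) < b := by exact_mod_cast (by omega : 1 < b)
  have h1 : Tendsto (fun N : ℕ => ((b : ℝ) ^ (-w)) ^ N) atTop (𝓝 0) :=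
    tendsto_pow_atTop_nhds_zero_of_lt_one (by positivity)
      (Real.rpow_lt_one_of_one_lt_of_neg hb1 (by linarith))
  refine h1.congr fun N => ?_
  rw [← Real.rpow_natCast, ← Real.rpow_mul (by positivity), neg_mul]

section Orbit

variable {b : ℕ} {ξ v : ℝ}

/-- Otherwise the distance at `n` would be exactly `b ^ (n - m)` times the one at `m`, hence no
smaller, and `n` would not be a record. -/
theorem half_lt_pow_mul_orbitDist (hb : 2 ≤ b) {n m : ℕ} (hn : IsRecord (orbitDist b ξ) n)
    (hm : 1 ≤ m) (hmn : m < n) : 1 / 2 < (b : ℝ) ^ (n - m) * orbitDist b ξ m := by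
  by_contra! h
  have h1 := distNearestInt_natCast_mul (c := b ^ (n - m)) (x := (b : ℝ) ^ m * ξ)
    (by rw [Nat.cast_pow]; exact h)
  rw [Nat.cast_pow, ← mul_assoc, ← pow_add, Nat.sub_add_cancel hmn.le] at h1
  have hb1 : (1 : ℝ) ≤ (b : ℝ) ^ (n - m) := one_le_pow₀ (by exact_mod_cast (by omega : 1 ≤ b))
  have h2 : orbitDist b ξ m ≤ orbitDist b ξ n := by
    rw [orbitDist, orbitDist, h1]
    exact le_mul_of_one_le_left (distNearestInt_nonneg _) hb1
  exact absurd (hn.2 m hm hmn) h2.not_gt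

theorem sub_one_lt_sub_of_orbitDist_lt (hb : 2 ≤ b) {n m : ℕ} {t : ℝ}
    (hn : IsRecord (orbitDist b ξ) n) (hm : 1 ≤ m) (hmn : m < n)
    (h : orbitDist b ξ m < (b : ℝ) ^ (-t)) : t - 1 < (n : ℝ) - m := by
  have hb1 : (1 : ℝ) < b := by exact_mod_cast (by omega : 1 < b)
  have hb0 : (0 : ℝ) < b := by linarith
  have hb2 : (2 : ℝ) ≤ b := by exact_mod_cast hb
  have h1 : (b : ℝ) ^ (-1 : ℝ) < (b : ℝ) ^ (((n : ℝ) - m) + -t) := by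
    calc (b : ℝ) ^ (-1 : ℝ) ≤ 1 / 2 := by
          rw [Real.rpow_neg_one, one_div]; gcongr
      _ < (b : ℝ) ^ (n - m) * orbitDist b ξ m := half_lt_pow_mul_orbitDist hb hn hm hmn
      _ ≤ (b : ℝ) ^ (n - m) * (b : ℝ) ^ (-t) := by gcongr
      _ = _ := by
        rw [Real.rpow_add hb0, ← Nat.cast_sub hmn.le, Real.rpow_natCast]
  have := (Real.rpow_lt_rpow_left_iff hb1).mp h1
  linarith

/-- The witness `m` minimises the distance over `[1, n - 1]`, so it is the record just before `n`;
the uniform approximation at `N = n - 1` bounds its distance. It cannot precede `r`, since the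
record `r` would beat it. -/
theorem exists_previous_record (hb : 2 ≤ b) {N₀ : ℕ}
    (hN₀ : ∀ N : ℕ, N₀ ≤ N → ∃ n : ℕ, 1 ≤ n ∧ n ≤ N ∧ orbitDist b ξ n < (b : ℝ) ^ (-(v * N)))
    {r n : ℕ} (hr : IsRecord (orbitDist b ξ) r) (hn : IsRecord (orbitDist b ξ) n) (hrn : r < n)
    (hr₀ : N₀ ≤ r) :
    ∃ m, r ≤ m ∧ m < n ∧ IsRecord (orbitDist b ξ) m ∧
      orbitDist b ξ m < (b : ℝ) ^ (-(v * ((n : ℝ) - 1))) ∧ v * ((n : ℝ) - 1) - 1 < (n : ℝ) - m := by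
  have hr1 := hr.1
  obtain ⟨m, hmn, hm, hmin⟩ := exists_isRecord_le (orbitDist b ξ) (N := n - 1) (by omega)
  obtain ⟨j, h1, h2, hj⟩ := hN₀ (n - 1) (by omega)
  rw [Nat.cast_sub (by omega), Nat.cast_one] at hj
  have hlt := (hmin j h1 h2).trans_lt hj
  refine ⟨m, ?_, by omega, hm, hlt, sub_one_lt_sub_of_orbitDist_lt hb hn hm.1 (by omega) hlt⟩
  by_contra! hmr
  exact absurd (hr.2 m hm.1 hmr) (hmin r hr1 (by omega)).not_gt

theorem exists_orbitDist_lt (hb : 2 ≤ b) (hv : 0 < v) {N₀ : ℕ}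
    (hN₀ : ∀ N : ℕ, N₀ ≤ N → ∃ n : ℕ, 1 ≤ n ∧ n ≤ N ∧ orbitDist b ξ n < (b : ℝ) ^ (-(v * N))) :
    ∀ ε > 0, ∃ n, 1 ≤ n ∧ orbitDist b ξ n < ε := by
  intro ε hε
  obtain ⟨N, hN, hle⟩ := (((tendsto_rpow_neg_mul_atTop hb hv).eventually_lt_const hε).and
    (eventually_ge_atTop N₀)).exists
  obtain ⟨n, h1, -, hn⟩ := hN₀ N hle
  exact ⟨n, h1, hn.trans hN⟩

theorem div_one_sub_le_expV (hb : 2 ≤ b) (hv : 0 < v) (hv1 : v < 1)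
    (h : (v : EReal) < expVHat b ξ) : ((v / (1 - v) : ℝ) : EReal) ≤ expV b ξ := by
  by_cases hz : ∃ n, orbitDist b ξ n = 0
  · obtain ⟨n, hn⟩ := hz
    rw [expV_eq_top_of_distNearestInt_eq_zero hb hn]
    exact le_top
  push Not at hz
  have hpos : ∀ n, 0 < orbitDist b ξ n := fun n =>
    (distNearestInt_nonneg _).lt_of_ne (hz n).symm
  obtain ⟨N₀, hN₀⟩ := eventually_of_lt_expVHat hb h
  have hrec := exists_isRecord_gt hpos (exists_orbitDist_lt hb hv hN₀)
  refine le_expV_of_forall_infinite fun w hw => infinite_of_forall_exists_gt fun B => ?_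
  have hc : 0 < v / (1 - v) - w := by linarith
  -- The gap between records reads `m - 2 < (1 - v) * (n - 1)`; taking `m ≥ K` makes the margin `v /
  -- (1 - v) - w` pay for the loss of 2.
  obtain ⟨K, hK⟩ := exists_nat_ge (2 * (v / (1 - v)) / (v / (1 - v) - w))
  obtain ⟨r, hr, hrr⟩ := hrec (B + N₀ + K)
  obtain ⟨n, hn, hnr⟩ := hrec r
  obtain ⟨m, hrm, hmn, hm, hlt, hgap⟩ := exists_previous_record hb hN₀ hrr hnr hn (by omega)
  refine ⟨m, ⟨hm.1, hlt.trans_le ?_⟩, by omega⟩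
  have hb1 : (1 : ℝ) ≤ b := by exact_mod_cast (by omega : 1 ≤ b)
  refine Real.rpow_le_rpow_of_exponent_le hb1 (neg_le_neg ?_)
  have hmK : (K : ℝ) ≤ m := by exact_mod_cast (by omega : K ≤ m)
  have h1 : 2 * (v / (1 - v)) ≤ m * (v / (1 - v) - w) := (div_le_iff₀ hc).mp (hK.trans hmK)
  have h2 : v / (1 - v) * (m - 2) ≤ v / (1 - v) * ((1 - v) * (n - 1)) := by
    have : 0 ≤ v / (1 - v) := div_nonneg hv.le (by linarith)
    gcongr
    linarith
  have h3 : v / (1 - v) * ((1 - v) * (n - 1)) = v * (n - 1) := by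
    field_simp [(by linarith : (1 - v) ≠ 0)]
  linarith

end Orbit

/-! ### Dimension of limsup sets by covering -/

theorem dimH_le_of_frequently_mem_closedBall {b : ℕ} (hb : 2 ≤ b) {α w D : ℝ} (hw : 0 < w)
    (hD : 0 ≤ D) (T : ℕ → Finset ℤ) (hT : ∀ n, ((T n).card : ℝ) ≤ D * (b : ℝ) ^ (α * n))
    {E : Set ℝ}
    (hE : ∀ ξ ∈ E, ∃ᶠ n in atTop, ∃ p ∈ T n, |ξ - p / (b : ℝ) ^ n| ≤ (b : ℝ) ^ (-(w * n))) :
    dimH E ≤ ENNReal.ofReal (α / w) := by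
  have hb1 : (1 : ℝ) < b := by exact_mod_cast (by omega : 1 < b)
  have hb0 : (0 : ℝ) < b := by linarith
  refine ENNReal.le_of_forall_pos_le_add fun ε hε _ => ?_
  set s : ℝ≥0 := (α / w).toNNReal + ε with hs
  have hsα : α < w * s := by
    have h1 : α / w < s := by
      rw [hs, NNReal.coe_add]
      have : (0 : ℝ) < ε := hε
      linarith [Real.le_coe_toNNReal (α / w)]
    rw [div_lt_iff₀ hw] at h1
    linarith
  suffices h : dimH E ≤ s by
    rw [hs, ENNReal.coe_add] at h
    exact h
  -- At level `m` the sum of the `s`-th powers of the diameters is at most a constant times `ρ ^ m`.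
  set ρ : ℝ := (b : ℝ) ^ (α - w * s) with hρ
  have hρ0 : 0 < ρ := by positivity
  have hρ1 : ρ < 1 := Real.rpow_lt_one_of_one_lt_of_neg hb1 (by linarith)
  have hdiam : ∀ (m : ℕ) (p : ℤ),
      Metric.ediam (Metric.closedBall ((p : ℝ) / (b : ℝ) ^ m) ((b : ℝ) ^ (-(w * m)))) =
        ENNReal.ofReal (2 * (b : ℝ) ^ (-(w * m))) := fun m p => by
    rw [Real.closedBall_eq_Icc, Real.ediam_Icc]
    congr 1
    ring
  have hsummand : ∀ m : ℕ,
      ∑' p : T m, Metric.ediam (Metric.closedBall (((p : ℤ) : ℝ) / (b : ℝ) ^ m)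
        ((b : ℝ) ^ (-(w * m)))) ^ (s : ℝ) ≤ ENNReal.ofReal (D * 2 ^ (s : ℝ) * ρ ^ m) := fun m => by
    simp_rw [hdiam]
    rw [ENNReal.ofReal_rpow_of_nonneg (by positivity) s.coe_nonneg, tsum_fintype,
      Finset.sum_const, nsmul_eq_mul, Finset.card_univ, Fintype.card_coe,
      ← ENNReal.ofReal_natCast, ← ENNReal.ofReal_mul (Nat.cast_nonneg _)]
    refine ENNReal.ofReal_le_ofReal ?_
    calc ((T m).card : ℝ) * (2 * (b : ℝ) ^ (-(w * m))) ^ (s : ℝ)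
        ≤ (D * (b : ℝ) ^ (α * m)) * (2 * (b : ℝ) ^ (-(w * m))) ^ (s : ℝ) := by
          gcongr
          exact hT m
      _ = D * 2 ^ (s : ℝ) * ((b : ℝ) ^ (α * m) * ((b : ℝ) ^ (-(w * m))) ^ (s : ℝ)) := by
          rw [Real.mul_rpow (by norm_num) (by positivity)]
          ring
      _ = D * 2 ^ (s : ℝ) * ρ ^ m := by
          rw [← Real.rpow_mul hb0.le, ← Real.rpow_add hb0, hρ, ← Real.rpow_natCast,
            ← Real.rpow_mul hb0.le]
          congr 2
          ring
  have hfin : ∑' m : ℕ, ENNReal.ofReal (D * 2 ^ (s : ℝ) * ρ ^ m) ≠ ⊤ := by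
    rw [← ENNReal.ofReal_tsum_of_nonneg (fun m => by positivity)
      ((summable_geometric_of_lt_one hρ0.le hρ1).mul_left _)]
    exact ENNReal.ofReal_ne_top
  refine dimH_le_of_hausdorffMeasure_ne_top (ne_top_of_le_ne_top hfin ?_)
  have hr : Tendsto (fun N : ℕ => ENNReal.ofReal (2 * (b : ℝ) ^ (-(w * N)))) atTop (𝓝 0) := by
    have h1 : Tendsto (fun N : ℕ => 2 * ((b : ℝ) ^ (-w)) ^ N) atTop (𝓝 (2 * 0)) :=
      (tendsto_pow_atTop_nhds_zero_of_lt_one (by positivity)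
        (Real.rpow_lt_one_of_one_lt_of_neg hb1 (by linarith))).const_mul _
    have h2 := ENNReal.tendsto_ofReal h1
    rw [mul_zero, ENNReal.ofReal_zero] at h2
    refine h2.congr fun N => ?_
    rw [← Real.rpow_natCast, ← Real.rpow_mul hb0.le, neg_mul]
  -- The `N`-th cover uses only levels `≥ N`, so its mesh tends to 0, while its sum stays below the
  -- full geometric series.
  refine (Measure.hausdorffMeasure_le_liminf_tsum (β := ℕ) (ι := fun N => Σ n : ℕ, T (n + N))
    (s : ℝ) E (l := atTop) _ hr
    (fun N i => Metric.closedBall (((i.2 : ℤ) : ℝ) / (b : ℝ) ^ (i.1 + N))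
      ((b : ℝ) ^ (-(w * ((i.1 + N : ℕ) : ℝ))))) ?_ ?_).trans ?_
  · refine Eventually.of_forall fun N i => ?_
    rw [hdiam]
    refine ENNReal.ofReal_le_ofReal ?_
    have : (N : ℝ) ≤ ((i.1 + N : ℕ) : ℝ) := by exact_mod_cast Nat.le_add_left _ _
    gcongr
    exact hb1.le
  · refine Eventually.of_forall fun N ξ hξ => ?_
    obtain ⟨n, hn, p, hp, hle⟩ := (frequently_atTop.mp (hE ξ hξ)) N
    obtain ⟨k, rfl⟩ := Nat.exists_eq_add_of_le' hn
    exact mem_iUnion.mpr ⟨⟨k, ⟨p, hp⟩⟩, by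
      rw [Metric.mem_closedBall, Real.dist_eq]
      exact hle⟩
  · refine liminf_le_of_le ?_ ?_
    · isBoundedDefault
    · intro c hc
      obtain ⟨N, hN⟩ := hc.exists
      refine hN.trans ?_
      refine (ENNReal.tsum_sigma fun (n : ℕ) (p : T (n + N)) =>
        Metric.ediam (Metric.closedBall (((p : ℤ) : ℝ) / (b : ℝ) ^ (n + N))
          ((b : ℝ) ^ (-(w * ((n + N : ℕ) : ℝ))))) ^ (s : ℝ)).le.trans ?_
      refine (ENNReal.tsum_le_tsum fun n => hsummand (n + N)).trans ?_
      exact ENNReal.tsum_comp_le_tsum_of_injective (add_left_injective N)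
        (fun m => ENNReal.ofReal (D * 2 ^ (s : ℝ) * ρ ^ m))

/-! ### Counting chains of nearest integers -/

/-- `RecordChain b v θ R M n p` says that `p` can be reached from a pair `(m, q)` with `m ≤ R` and
`|q| ≤ M` along steps whose lengths and widths are those between the integers nearest to
`b ^ m * ξ` and `b ^ n * ξ`, for consecutive records `m < n`. -/
inductive RecordChain (b : ℕ) (v θ : ℝ) (R M : ℕ) : ℕ → ℤ → Prop
  | base {n : ℕ} {p : ℤ} : n ≤ R → |p| ≤ M → RecordChain b v θ R M n p
  | step {m n : ℕ} {q p : ℤ} : RecordChain b v θ R M m q → R < n → m < n → (n : ℝ) ≤ θ * m →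
      v * ((n : ℝ) - 1) - 1 < (n : ℝ) - m →
      |(p : ℝ) - (b : ℝ) ^ (n - m) * q| ≤ 2 * (b : ℝ) ^ (((n : ℝ) - m) - v * ((n : ℝ) - 1)) →
      RecordChain b v θ R M n p

theorem exists_finset_of_abs_sub_le (z x : ℝ) (hx : 0 ≤ x) :
    ∃ T : Finset ℤ, (∀ p : ℤ, |(p : ℝ) - z| ≤ x → p ∈ T) ∧ (T.card : ℝ) ≤ 2 * x + 1 := by
  refine ⟨Finset.Icc ⌈z - x⌉ ⌊z + x⌋, fun p hp => ?_, ?_⟩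
  · rw [abs_le] at hp
    exact Finset.mem_Icc.mpr ⟨Int.ceil_le.mpr (by linarith), Int.le_floor.mpr (by linarith)⟩
  · rw [Int.card_Icc]
    have h1 := Int.floor_le (z + x)
    have h2 := Int.le_ceil (z - x)
    rcases le_total 0 (⌊z + x⌋ + 1 - ⌈z - x⌉) with h | h
    · have : (((⌊z + x⌋ + 1 - ⌈z - x⌉).toNat : ℤ) : ℝ) = (⌊z + x⌋ + 1 - ⌈z - x⌉ : ℤ) := by
        rw [Int.toNat_of_nonneg h]
      rw [Int.cast_natCast] at this
      rw [this]
      push_cast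
      linarith
    · rw [Int.toNat_of_nonpos h]
      push_cast
      linarith

/-- Strong induction on `n`. A predecessor `m` contributes about `b ^ (α m + (n - m) - v n)`, and `m
≥ n / θ` makes this at most `b ^ ((α - ε) n)` up to a constant. The spare `b ^ (ε n)` absorbs that
constant and the at most `n` choices of `m`. -/
theorem RecordChain.exists_finset {b : ℕ} (hb : 2 ≤ b) {v θ α ε : ℝ} {R : ℕ} (M : ℕ)
    (hv1 : v ≤ 1) (hθ : 0 < θ) (hα0 : 0 ≤ α) (hα1 : α ≤ 1)
    (hε : 1 - v - (1 - α) / θ ≤ α - ε)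
    (hR : ∀ n : ℕ, R < n → 5 * (b : ℝ) ^ 2 * n ≤ (b : ℝ) ^ (ε * n)) (n : ℕ) :
    ∃ T : Finset ℤ, (∀ p, RecordChain b v θ R M n p → p ∈ T) ∧
      (T.card : ℝ) ≤ (2 * M + 1) * (b : ℝ) ^ (α * n) := by
  have hb1 : (1 : ℝ) < b := by exact_mod_cast (by omega : 1 < b)
  have hb0 : (0 : ℝ) < b := by linarith
  induction n using Nat.strong_induction_on with
  | _ n ih =>
  rcases le_or_gt n R with hnR | hnR
  · refine ⟨Finset.Icc (-M) M, fun p hp => ?_, ?_⟩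
    · cases hp with
      | base _ h => exact Finset.mem_Icc.mpr (abs_le.mp h)
      | step _ h => omega
    · rw [Int.card_Icc]
      have h1 : (((M : ℤ) + 1 - -M).toNat : ℝ) = 2 * M + 1 := by
        rw [show ((M : ℤ) + 1 - -M) = ((2 * M + 1 : ℕ) : ℤ) by push_cast; ring, Int.toNat_natCast]
        push_cast
        ring
      rw [h1]
      exact le_mul_of_one_le_right (by positivity) (Real.one_le_rpow hb1.le (by positivity))
  · choose! T hT hcard using ih
    choose I hI hIcard using fun (m : ℕ) (q : ℤ) => exists_finset_of_abs_sub_le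
      ((b : ℝ) ^ (n - m) * q) (2 * (b : ℝ) ^ (((n : ℝ) - m) - v * ((n : ℝ) - 1))) (by positivity)
    classical
    let A := (Finset.range n).filter fun m : ℕ =>
      (n : ℝ) ≤ θ * m ∧ v * ((n : ℝ) - 1) - 1 < (n : ℝ) - m
    refine ⟨A.biUnion fun m => (T m).biUnion (I m), fun p hp => ?_, ?_⟩
    · cases hp with
      | base h => omega
      | @step m _ q _ hc _ hmn h1 h2 h3 =>
        simp only [A, Finset.mem_biUnion, Finset.mem_filter, Finset.mem_range]
        exact ⟨m, ⟨hmn, h1, h2⟩, q, hT m hmn q hc, hI m q p h3⟩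
    · have hA : ∀ m ∈ A, ((((T m).biUnion (I m)).card : ℕ) : ℝ) ≤
          (2 * M + 1) * (5 * (b : ℝ) ^ 2 * (b : ℝ) ^ ((α - ε) * n)) := by
        intro m hm
        simp only [A, Finset.mem_filter, Finset.mem_range] at hm
        obtain ⟨hmn, h1, h2⟩ := hm
        set X := (b : ℝ) ^ (((n : ℝ) - m) - v * ((n : ℝ) - 1)) with hX
        -- The gap condition keeps the exponent of `X` above `-1`; hence the interval count `4 * X +
        -- 1` is at most `5 * (b * X)`.
        have hX1 : 1 ≤ b * X := by
          rw [hX, ← Real.rpow_one_add' hb0.le (by linarith)]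
          exact Real.one_le_rpow hb1.le (by linarith)
        have hI' : ∀ q, ((I m q).card : ℝ) ≤ 5 * (b * X) := fun q => by
          refine (hIcard m q).trans ?_
          nlinarith [Real.rpow_pos_of_pos hb0 (((n : ℝ) - m) - v * ((n : ℝ) - 1))]
        calc ((((T m).biUnion (I m)).card : ℕ) : ℝ) ≤ ∑ q ∈ T m, ((I m q).card : ℝ) := by
              exact_mod_cast Finset.card_biUnion_le
          _ ≤ ∑ q ∈ T m, 5 * (b * X) := Finset.sum_le_sum fun q _ => hI' q
          _ = (T m).card * (5 * (b * X)) := by rw [Finset.sum_const, nsmul_eq_mul]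
          _ ≤ ((2 * M + 1) * (b : ℝ) ^ (α * m)) * (5 * (b * X)) := by
              gcongr
              exact hcard m hmn
          _ = (2 * M + 1) * (5 * ((b : ℝ) ^ (α * m) * (b * X))) := by ring
          _ ≤ (2 * M + 1) * (5 * ((b : ℝ) ^ 2 * (b : ℝ) ^ ((α - ε) * n))) := by
              refine mul_le_mul_of_nonneg_left (mul_le_mul_of_nonneg_left ?_ (by norm_num))
                (by positivity)
              have h3 : (b : ℝ) ^ (α * m) * (b * X) =
                  (b : ℝ) ^ (α * m + (1 + (((n : ℝ) - m) - v * ((n : ℝ) - 1)))) := by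
                rw [Real.rpow_add hb0, Real.rpow_add hb0, Real.rpow_one]
              have h4 : (b : ℝ) ^ 2 * (b : ℝ) ^ ((α - ε) * n) =
                  (b : ℝ) ^ (2 + (α - ε) * n) := by
                rw [Real.rpow_add hb0, Real.rpow_two]
              rw [h3, h4]
              refine Real.rpow_le_rpow_of_exponent_le hb1.le ?_
              have h5 : (1 - v - (1 - α) / θ) * n ≤ (α - ε) * n := by gcongr
              have h6 : (1 - α) / θ * n ≤ (1 - α) * m := by
                rw [div_mul_eq_mul_div, div_le_iff₀ hθ]
                nlinarith
              linarith
          _ = _ := by ring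
      calc (((A.biUnion fun m => (T m).biUnion (I m)).card : ℕ) : ℝ)
          ≤ ∑ m ∈ A, (((T m).biUnion (I m)).card : ℝ) := by
            exact_mod_cast Finset.card_biUnion_le
        _ ≤ ∑ m ∈ A, (2 * M + 1) * (5 * (b : ℝ) ^ 2 * (b : ℝ) ^ ((α - ε) * n)) :=
            Finset.sum_le_sum hA
        _ = A.card * ((2 * M + 1) * (5 * (b : ℝ) ^ 2 * (b : ℝ) ^ ((α - ε) * n))) := by
            rw [Finset.sum_const, nsmul_eq_mul]
        _ ≤ n * ((2 * M + 1) * (5 * (b : ℝ) ^ 2 * (b : ℝ) ^ ((α - ε) * n))) := by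
            gcongr
            exact_mod_cast (Finset.card_filter_le _ _).trans (Finset.card_range n).le
        _ = (2 * M + 1) * ((5 * (b : ℝ) ^ 2 * n) * (b : ℝ) ^ ((α - ε) * n)) := by ring
        _ ≤ (2 * M + 1) * ((b : ℝ) ^ (ε * n) * (b : ℝ) ^ ((α - ε) * n)) := by
            gcongr
            exact hR n hnR
        _ = (2 * M + 1) * (b : ℝ) ^ (α * n) := by
            rw [← Real.rpow_add hb0]
            congr 2
            ring

section Chain

variable {b : ℕ} {ξ v w θ : ℝ}

/-- A good approximation at `N` passes to the record `n ≤ N` realising the minimum up to `N`: its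
distance is no larger and its threshold is weaker. -/
theorem exists_isRecord_orbitDist_lt (hw : 0 < w) (hb : 2 ≤ b)
    (hrec : ∀ B, ∃ n > B, IsRecord (orbitDist b ξ) n)
    (h : {n : ℕ | 1 ≤ n ∧ orbitDist b ξ n < (b : ℝ) ^ (-(w * n))}.Infinite)
    (hpos : ∀ n, 0 < orbitDist b ξ n) (B : ℕ) :
    ∃ n > B, IsRecord (orbitDist b ξ) n ∧ orbitDist b ξ n < (b : ℝ) ^ (-(w * n)) := by
  obtain ⟨r, hrB, hr⟩ := hrec B
  obtain ⟨K, hK⟩ := ((tendsto_rpow_neg_mul_atTop hb hw).eventually_lt_const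
    (hpos r)).exists_forall_of_atTop
  obtain ⟨N, ⟨hN1, hN⟩, hNgt⟩ := h.exists_gt (max r K)
  obtain ⟨n, hnN, hn, hmin⟩ := exists_isRecord_le (orbitDist b ξ) hN1
  have hnN' : (n : ℝ) ≤ N := by exact_mod_cast hnN
  have hb1 : (1 : ℝ) ≤ b := by exact_mod_cast (by omega : 1 ≤ b)
  refine ⟨n, ?_, hn, ((hmin N hN1 le_rfl).trans_lt hN).trans_le (by gcongr)⟩
  by_contra! hnB
  exact absurd (hr.2 n hn.1 (by omega))
    (hmin r hr.1 ((le_max_left r K).trans hNgt.le)).not_gt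

theorem recordChain_of_isRecord (hb : 2 ≤ b) {u : ℝ} (hv : 0 < v) (hu : u < θ * v)
    (hpos : ∀ n, 0 < orbitDist b ξ n) (hhat : (v : EReal) < expVHat b ξ)
    (hexp : expV b ξ < (u : EReal)) (R₁ : ℕ) :
    ∃ R ≥ R₁, ∃ M : ℕ, ∀ n ≥ R, IsRecord (orbitDist b ξ) n →
      RecordChain b v θ R M n (round ((b : ℝ) ^ n * ξ)) := by
  have hb1 : (1 : ℝ) < b := by exact_mod_cast (by omega : 1 < b)
  have hb0 : (0 : ℝ) < b := by linarith
  obtain ⟨N₀, hN₀⟩ := eventually_of_lt_expVHat hb hhat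
  obtain ⟨n₀, hn₀⟩ := eventually_le_of_expV_lt hexp
  have hrec := exists_isRecord_gt hpos (exists_orbitDist_lt hb hv hN₀)
  -- Comparing both bounds on the distance at `m` gives `v * (n - 1) < u * m`; for `m ≥ K` the extra
  -- `v` fits into `m * (θ * v - u)`, so `n ≤ θ * m`.
  obtain ⟨K, hK⟩ := exists_nat_ge (v / (θ * v - u))
  obtain ⟨R, hR, hRr⟩ := hrec (R₁ + N₀ + n₀ + K)
  refine ⟨R, by omega, (round ((b : ℝ) ^ R * ξ)).natAbs, fun n => ?_⟩
  induction n using Nat.strong_induction_on with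
  | _ n ih =>
  intro hnR hn
  rcases hnR.eq_or_lt with rfl | hlt
  · exact RecordChain.base le_rfl (by rw [Int.natCast_natAbs])
  obtain ⟨m, hRm, hmn, hm, hδ, hgap⟩ := exists_previous_record hb hN₀ hRr hn hlt (by omega)
  refine RecordChain.step (ih m hmn hRm hm) hlt hmn ?_ hgap ?_
  · have h1 := (hn₀ m (by omega)).trans_lt hδ
    have h2 := (Real.rpow_lt_rpow_left_iff hb1).mp h1
    have hKm : (K : ℝ) ≤ m := by exact_mod_cast (by omega : K ≤ m)
    have h3 : v ≤ m * (θ * v - u) := (div_le_iff₀ (by linarith)).mp (hK.trans hKm)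
    refine le_of_mul_le_mul_left (a := v) ?_ hv
    linarith
  · have h1 : (b : ℝ) ^ (n - m) * ((b : ℝ) ^ m * ξ) = (b : ℝ) ^ n * ξ := by
      rw [← mul_assoc, ← pow_add, Nat.sub_add_cancel hmn.le]
    have h2 : (b : ℝ) ^ (((n : ℝ) - m) - v * ((n : ℝ) - 1)) =
        (b : ℝ) ^ (n - m) * (b : ℝ) ^ (-(v * ((n : ℝ) - 1))) := by
      rw [sub_eq_add_neg (_ - _), Real.rpow_add hb0, ← Nat.cast_sub hmn.le, Real.rpow_natCast]
    have hone : (1 : ℝ) ≤ (b : ℝ) ^ (n - m) := one_le_pow₀ hb1.le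
    calc |(round ((b : ℝ) ^ n * ξ) : ℝ) - (b : ℝ) ^ (n - m) * round ((b : ℝ) ^ m * ξ)|
        = |((b : ℝ) ^ (n - m) * ((b : ℝ) ^ m * ξ - round ((b : ℝ) ^ m * ξ))) -
            ((b : ℝ) ^ n * ξ - round ((b : ℝ) ^ n * ξ))| := by
          rw [mul_sub, h1]
          congr 1
          ring
      _ ≤ (b : ℝ) ^ (n - m) * orbitDist b ξ m + orbitDist b ξ n := by
          refine (abs_sub _ _).trans_eq ?_
          rw [abs_mul, abs_of_pos (by positivity : (0 : ℝ) < (b : ℝ) ^ (n - m))]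
          rfl
      _ ≤ (b : ℝ) ^ (n - m) * orbitDist b ξ m + (b : ℝ) ^ (n - m) * orbitDist b ξ m := by
          gcongr
          exact (hn.2 m hm.1 hmn).le.trans
            (le_mul_of_one_le_left (hpos m).le hone)
      _ = 2 * ((b : ℝ) ^ (n - m) * orbitDist b ξ m) := by ring
      _ ≤ 2 * (b : ℝ) ^ (((n : ℝ) - m) - v * ((n : ℝ) - 1)) := by
          rw [h2]
          gcongr

end Chain

/-! ### Upper bounds for the dimensions, and emptiness -/

theorem eventually_mul_natCast_le_rpow {b : ℕ} (hb : 2 ≤ b) {ε : ℝ} (hε : 0 < ε) (C : ℝ) :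
    ∃ R : ℕ, ∀ n : ℕ, R < n → C * n ≤ (b : ℝ) ^ (ε * n) := by
  have hb1 : (1 : ℝ) < b := by exact_mod_cast (by omega : 1 < b)
  have h := tendsto_pow_const_mul_const_pow_of_abs_lt_one 1 (r := (b : ℝ) ^ (-ε)) (by
    rw [abs_of_pos (by positivity)]
    exact Real.rpow_lt_one_of_one_lt_of_neg hb1 (by linarith))
  have h2 := h.const_mul C
  rw [mul_zero] at h2
  obtain ⟨R, hR⟩ := (h2.eventually_lt_const one_pos).exists_forall_of_atTop
  refine ⟨R, fun n hn => ?_⟩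
  have h3 := hR n hn.le
  rw [pow_one, ← Real.rpow_natCast, ← Real.rpow_mul (by positivity), ← mul_assoc, neg_mul,
    Real.rpow_neg (by positivity), ← div_eq_mul_inv, div_lt_one (by positivity)] at h3
  exact h3.le

theorem abs_sub_div_pow_le {b : ℕ} (hb : 2 ≤ b) {ξ w : ℝ} {n : ℕ}
    (h : orbitDist b ξ n < (b : ℝ) ^ (-(w * n))) :
    |ξ - round ((b : ℝ) ^ n * ξ) / (b : ℝ) ^ n| ≤ (b : ℝ) ^ (-((1 + w) * n)) := by
  have hb0 : (0 : ℝ) < b := by exact_mod_cast (by omega : 0 < b)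
  have hbn : (0 : ℝ) < (b : ℝ) ^ n := by positivity
  have h1 : ξ - round ((b : ℝ) ^ n * ξ) / (b : ℝ) ^ n =
      ((b : ℝ) ^ n * ξ - round ((b : ℝ) ^ n * ξ)) / (b : ℝ) ^ n := by
    field_simp
  have h2 : (b : ℝ) ^ (-((1 + w) * n)) = (b : ℝ) ^ (-(w * n)) / (b : ℝ) ^ n := by
    rw [← Real.rpow_natCast b n, ← Real.rpow_sub hb0]
    congr 1
    ring
  rw [h1, h2, abs_div, abs_of_pos hbn]
  gcongr
  exact h.le

/-- The strict inequality `hα` leaves room to enlarge `θ` to `θ'`, shrink `vhat` to `v`, and place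
`u` between `θ * vhat` and `θ' * v`, so that the chain count applies. -/
theorem dimH_le_of_lt {b : ℕ} (hb : 2 ≤ b) {vhat θ α w : ℝ} (hv : 0 < vhat) (hv1 : vhat < 1)
    (hθ : 0 < θ) (hα0 : 0 ≤ α) (hα1 : α < 1) (hα : (1 - α) * (1 - 1 / θ) < vhat)
    (hw : 0 < w) (hwv : w < θ * vhat) :
    dimH ({ξ : ℝ | expVHat b ξ = (vhat : EReal)} ∩
      {ξ : ℝ | expV b ξ = ((θ * vhat : ℝ) : EReal)}) ≤ ENNReal.ofReal (α / (1 + w)) := by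
  obtain ⟨θ', hθθ', hθ'⟩ : ∃ θ' > θ, (1 - α) * (1 - 1 / θ') < vhat := by
    have hc : ContinuousAt (fun t : ℝ => (1 - α) * (1 - 1 / t)) θ := by
      have := hθ.ne'
      fun_prop (disch := assumption)
    exact ((hc.eventually_lt_const hα).filter_mono nhdsWithin_le_nhds |>.and
      (self_mem_nhdsWithin (s := Ioi θ))).exists.imp fun t ht => ⟨ht.2, ht.1⟩
  have hθ'0 : 0 < θ' := hθ.trans hθθ'
  have hmax : max (max ((1 - α) * (1 - 1 / θ')) (θ * vhat / θ')) 0 < vhat := by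
    refine max_lt (max_lt hθ' ?_) hv
    rw [div_lt_iff₀ hθ'0]
    nlinarith
  obtain ⟨v, hv', hvv⟩ := exists_between hmax
  obtain ⟨⟨hva, hvb⟩, hv0⟩ : ((1 - α) * (1 - 1 / θ') < v ∧ θ * vhat / θ' < v) ∧ 0 < v := by
    simpa only [max_lt_iff] using hv'
  obtain ⟨u, hu, hu'⟩ : ∃ u, θ * vhat < u ∧ u < θ' * v := by
    refine exists_between ?_
    rw [div_lt_iff₀ hθ'0] at hvb
    linarith
  set ε : ℝ := (v - (1 - α) * (1 - 1 / θ')) with hε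
  obtain ⟨R₁, hR₁⟩ := eventually_mul_natCast_le_rpow hb (sub_pos.mpr hva) (5 * (b : ℝ) ^ 2)
  have hcount : ∀ R ≥ R₁, ∀ M n : ℕ, ∃ T : Finset ℤ, (∀ p, RecordChain b v θ' R M n p → p ∈ T) ∧
      (T.card : ℝ) ≤ (2 * M + 1) * (b : ℝ) ^ (α * n) := fun R hR M n => by
    refine RecordChain.exists_finset hb M (by linarith) hθ'0 hα0 hα1.le (ε := ε) ?_
      (fun n hn => hR₁ n (by omega)) n
    rw [hε, div_eq_mul_one_div (1 - α) θ']
    linarith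
  -- The starting record and the bound on its nearest integer depend on `ξ`; a countable union over
  -- both does not raise the dimension.
  let F : ℕ × ℕ → Set ℝ := fun RM => {ξ | RM.1 ≥ R₁ ∧ ∃ᶠ n in atTop, ∃ p,
    RecordChain b v θ' RM.1 RM.2 n p ∧ |ξ - p / (b : ℝ) ^ n| ≤ (b : ℝ) ^ (-((1 + w) * n))}
  have hF : ∀ RM, dimH (F RM) ≤ ENNReal.ofReal (α / (1 + w)) := fun ⟨R, M⟩ => by
    by_cases hR : R ≥ R₁
    · choose T hT hTcard using hcount R hR M
      refine dimH_le_of_frequently_mem_closedBall hb (by linarith) (by positivity) T hTcard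
        fun ξ hξ => hξ.2.mono fun n ⟨p, hp, hle⟩ => ⟨p, hT n p hp, hle⟩
    · have : F (R, M) = ∅ := by
        ext ξ
        simp [F, hR]
      rw [this, dimH_empty]
      exact zero_le
  refine (dimH_mono (t := ⋃ RM, F RM) ?_).trans ?_
  · rintro ξ ⟨hξ1, hξ2⟩
    have hξ1 : expVHat b ξ = (vhat : EReal) := hξ1
    have hξ2 : expV b ξ = ((θ * vhat : ℝ) : EReal) := hξ2
    have hpos : ∀ n, 0 < orbitDist b ξ n := fun n =>
      (distNearestInt_nonneg _).lt_of_ne fun h0 => by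
        rw [expV_eq_top_of_distNearestInt_eq_zero hb h0.symm] at hξ2
        exact EReal.coe_ne_top _ hξ2.symm
    have hvlt : (v : EReal) < expVHat b ξ := by
      rw [hξ1]
      exact_mod_cast hvv
    obtain ⟨R, hR, M, hchain⟩ := recordChain_of_isRecord hb (u := u) hv0 hu' hpos hvlt
      (by rw [hξ2]; exact_mod_cast hu) R₁
    obtain ⟨N₀, hN₀⟩ := eventually_of_lt_expVHat hb hvlt
    have hrec := exists_isRecord_gt hpos (exists_orbitDist_lt hb hv0 hN₀)
    have hinf := infinite_of_lt_expV (v := w) (ξ := ξ) hb (by rw [hξ2]; exact_mod_cast hwv)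
    refine mem_iUnion.mpr ⟨(R, M), hR, frequently_atTop.mpr fun B => ?_⟩
    obtain ⟨n, hn, hnr, hlt⟩ := exists_isRecord_orbitDist_lt hw hb hrec hinf hpos
      (B + R)
    exact ⟨n, by omega, _, hchain n (by omega) hnr, abs_sub_div_pow_le hb hlt⟩
  · rw [dimH_iUnion]
    exact iSup_le hF

theorem dimH_le_of_one_div_le {b : ℕ} (hb : 2 ≤ b) {vhat θ : ℝ} (hv : 0 < vhat) (hv1 : vhat < 1)
    (hθ : 1 / (1 - vhat) ≤ θ) :
    dimH ({ξ : ℝ | expVHat b ξ = (vhat : EReal)} ∩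
      {ξ : ℝ | expV b ξ = ((θ * vhat : ℝ) : EReal)}) ≤
      ENNReal.ofReal ((θ - 1 - θ * vhat) / ((1 + θ * vhat) * (θ - 1))) := by
  have h1v : 0 < 1 - vhat := by linarith
  have hθ' : 1 ≤ θ * (1 - vhat) := (div_le_iff₀ h1v).mp hθ
  have hθ1 : 1 < θ := by nlinarith
  have hθ0 : 0 < θ := by linarith
  have hθv : 0 < θ * vhat := mul_pos hθ0 hv
  -- This is the critical `α`, solving `(1 - a) * (1 - 1 / θ) = vhat`; the estimate is applied at `a
  -- + t` and `θ * vhat - t`, with `t → 0+`.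
  set a : ℝ := (θ - 1 - θ * vhat) / (θ - 1) with ha
  have ha0 : 0 ≤ a := div_nonneg (by linarith) (by linarith)
  have ha1 : a < 1 := by
    rw [ha, div_lt_one (by linarith)]
    linarith
  have hca : (1 - a) * (1 - 1 / θ) = vhat := by
    rw [ha]
    have : θ - 1 ≠ 0 := by linarith
    field_simp
    ring
  have hval : (θ - 1 - θ * vhat) / ((1 + θ * vhat) * (θ - 1)) = a / (1 + θ * vhat) := by
    rw [ha, div_div, mul_comm (θ - 1)]
  rw [hval]
  have hlim : Tendsto (fun t : ℝ => ENNReal.ofReal ((a + t) / (1 + (θ * vhat - t)))) (𝓝[>] 0)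
      (𝓝 (ENNReal.ofReal ((a + 0) / (1 + (θ * vhat - 0))))) := by
    refine ENNReal.tendsto_ofReal (Tendsto.mono_left ?_ nhdsWithin_le_nhds)
    have hc : ContinuousAt (fun t : ℝ => (a + t) / (1 + (θ * vhat - t))) 0 := by
      have : (1 : ℝ) + (θ * vhat - 0) ≠ 0 := by linarith
      fun_prop (disch := assumption)
    exact hc
  rw [add_zero, sub_zero] at hlim
  refine ge_of_tendsto hlim ?_
  have hmin : (0 : ℝ) < min (1 - a) (θ * vhat) := lt_min (by linarith) hθv
  filter_upwards [Ioo_mem_nhdsGT hmin] with t ⟨ht0, ht⟩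
  have ht1 := ht.trans_le (min_le_left _ _)
  have ht2 := ht.trans_le (min_le_right _ _)
  refine dimH_le_of_lt hb hv hv1 hθ0 (by linarith) (by linarith) ?_ (by linarith) (by linarith)
  rw [← hca]
  have : 1 / θ < 1 := (div_lt_one hθ0).mpr hθ1
  nlinarith

/-- On `|ξ| ≤ M` all numerators are allowed, so `α = 1`, while `w` may be arbitrarily large. -/
theorem dimH_setOf_expV_eq_top {b : ℕ} (hb : 2 ≤ b) : dimH {ξ : ℝ | expV b ξ = ⊤} = 0 := by
  have hb1 : (1 : ℝ) < b := by exact_mod_cast (by omega : 1 < b)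
  have hb0 : (0 : ℝ) < b := by linarith
  have hle : ∀ w : ℝ, 0 < w → dimH {ξ : ℝ | expV b ξ = ⊤} ≤ ENNReal.ofReal (1 / (1 + w)) := by
    intro w hw
    let F : ℕ → Set ℝ := fun M => {ξ | |ξ| ≤ M ∧ expV b ξ = ⊤}
    have hF : ∀ M, dimH (F M) ≤ ENNReal.ofReal (1 / (1 + w)) := fun M => by
      choose T hT hTcard using fun n : ℕ =>
        exists_finset_of_abs_sub_le 0 ((b : ℝ) ^ n * M + 1) (by positivity)
      refine dimH_le_of_frequently_mem_closedBall hb (by linarith) (D := 2 * M + 3) (by positivity)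
        T (fun n => (hTcard n).trans ?_) ?_
      · rw [one_mul, Real.rpow_natCast]
        nlinarith [one_le_pow₀ (n := n) hb1.le]
      · rintro ξ ⟨hξM, hξ⟩
        have hinf := infinite_of_lt_expV (v := w) (ξ := ξ) hb (by rw [hξ]; exact EReal.coe_lt_top w)
        refine frequently_atTop.mpr fun B => ?_
        obtain ⟨n, ⟨-, hn⟩, hBn⟩ := hinf.exists_gt B
        refine ⟨n, hBn.le, _, hT n _ ?_, abs_sub_div_pow_le hb hn⟩
        have h1 : |(b : ℝ) ^ n * ξ| ≤ (b : ℝ) ^ n * M := by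
          rw [abs_mul, abs_of_pos (by positivity : (0 : ℝ) < (b : ℝ) ^ n)]
          gcongr
        have h2 := abs_sub_round ((b : ℝ) ^ n * ξ)
        rw [abs_le] at h1 h2 ⊢
        constructor <;> linarith
    refine (dimH_mono (t := ⋃ M, F M) fun ξ hξ => ?_).trans ?_
    · obtain ⟨M, hM⟩ := exists_nat_ge |ξ|
      exact mem_iUnion.mpr ⟨M, hM, hξ⟩
    · rw [dimH_iUnion]
      exact iSup_le hF
  refine le_antisymm ?_ zero_le
  have hlim : Tendsto (fun w : ℝ => ENNReal.ofReal (1 / (1 + w))) atTop (𝓝 0) := by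
    rw [← ENNReal.ofReal_zero]
    refine ENNReal.tendsto_ofReal ?_
    simp_rw [one_div]
    exact tendsto_inv_atTop_zero.comp (tendsto_atTop_add_const_left _ _ tendsto_id)
  exact ge_of_tendsto hlim ((eventually_gt_atTop 0).mono hle)

theorem expV_eq_top_of_one_le_expVHat {b : ℕ} (hb : 2 ≤ b) {ξ : ℝ} (h : 1 ≤ expVHat b ξ) :
    expV b ξ = ⊤ := by
  refine EReal.eq_top_iff_forall_lt _ |>.mpr fun y => ?_
  set u : ℝ := max y 0 + 1 with hu
  have hu0 : 0 < u := by positivity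
  have hyu : y < u := (le_max_left y 0).trans_lt (lt_add_one _)
  -- The map `u ↦ u / (1 + u)` inverts `v ↦ v / (1 - v)`.
  have hv1 : u / (1 + u) < 1 := (div_lt_one (by linarith)).mpr (by linarith)
  have hlt : ((u / (1 + u) : ℝ) : EReal) < expVHat b ξ :=
    lt_of_lt_of_le (by exact_mod_cast hv1) h
  have hle := div_one_sub_le_expV hb (div_pos hu0 (by linarith)) hv1 hlt
  have hval : u / (1 + u) / (1 - u / (1 + u)) = u := by
    have : 1 + u ≠ 0 := by linarith
    field_simp
    ring
  rw [hval] at hle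
  exact lt_of_lt_of_le (by exact_mod_cast hyu) hle

theorem inter_eq_empty_of_lt {b : ℕ} (hb : 2 ≤ b) {vhat θ : ℝ} (hv : 0 < vhat)
    (hv1 : vhat < 1) (hθ : θ < 1 / (1 - vhat)) :
    {ξ : ℝ | (vhat : EReal) ≤ expVHat b ξ} ∩
      {ξ : ℝ | expV b ξ = ((θ * vhat : ℝ) : EReal)} = ∅ := by
  refine eq_empty_of_forall_notMem ?_
  rintro ξ ⟨h1, h2⟩
  have h1 : (vhat : EReal) ≤ expVHat b ξ := h1
  have h2 : expV b ξ = ((θ * vhat : ℝ) : EReal) := h2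
  have hlt : θ * vhat < vhat / (1 - vhat) := by
    rw [div_eq_mul_one_div, mul_comm]
    gcongr
  have hc : ContinuousAt (fun v : ℝ => v / (1 - v)) vhat := by
    have : 1 - vhat ≠ 0 := by linarith
    fun_prop (disch := assumption)
  have hev : ∀ᶠ v in 𝓝[<] vhat, θ * vhat < v / (1 - v) :=
    (hc.eventually_const_lt hlt).filter_mono nhdsWithin_le_nhds
  obtain ⟨v, hvlt, hv0, hvv⟩ := (hev.and (Ioo_mem_nhdsLT hv)).exists
  have hle := div_one_sub_le_expV hb hv0 (hvv.trans hv1)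
    (lt_of_lt_of_le (by exact_mod_cast hvv) h1)
  rw [h2] at hle
  exact absurd (by exact_mod_cast hle : v / (1 - v) ≤ θ * vhat) hvlt.not_ge

/-! ### Digit expansions and a Hölder map -/

section Digits

variable {b : ℕ}

theorem ofDigits_eq_head_add (a : ℕ → Fin b) :
    Real.ofDigits a = ((a 0 : ℕ) + Real.ofDigits fun i => a (i + 1)) / b := by
  rw [Real.ofDigits_eq_sum_add_ofDigits a 1]
  simp only [Finset.range_one, Real.ofDigitsTerm, Finset.sum_singleton, zero_add, pow_one]
  ring

theorem inv_pow_le_ofDigits (a : ℕ → Fin b) {r : ℕ} (hr : 1 ≤ (a r : ℕ)) :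
    ((b : ℝ) ^ (r + 1))⁻¹ ≤ Real.ofDigits a := by
  have hb0 : (0 : ℝ) < b := by exact_mod_cast Fin.pos (a 0)
  induction r generalizing a with
  | zero =>
    rw [ofDigits_eq_head_add, zero_add, pow_one, inv_eq_one_div]
    have h1 : (1 : ℝ) ≤ (a 0 : ℕ) := by exact_mod_cast hr
    have h2 := Real.ofDigits_nonneg fun i => a (i + 1)
    gcongr
    linarith
  | succ r ih =>
    have h1 := ih (fun i => a (i + 1)) hr
    rw [ofDigits_eq_head_add, pow_succ, mul_inv, ← div_eq_mul_inv]
    have h2 : (0 : ℝ) ≤ (a 0 : ℕ) := Nat.cast_nonneg _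
    gcongr
    linarith

theorem ofDigits_le_one_sub_inv_pow (a : ℕ → Fin b) {r : ℕ} (hr : (a r : ℕ) + 1 < b) :
    Real.ofDigits a ≤ 1 - ((b : ℝ) ^ (r + 1))⁻¹ := by
  have hb0 : (0 : ℝ) < b := by exact_mod_cast Fin.pos (a 0)
  induction r generalizing a with
  | zero =>
    rw [ofDigits_eq_head_add, zero_add, pow_one, div_le_iff₀ hb0, sub_mul, inv_mul_cancel₀ hb0.ne']
    have h1 : ((a 0 : ℕ) : ℝ) + 2 ≤ b := by exact_mod_cast (by omega : (a 0 : ℕ) + 2 ≤ b)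
    have h2 := Real.ofDigits_le_one fun i => a (i + 1)
    linarith
  | succ r ih =>
    have h1 := ih (fun i => a (i + 1)) hr
    rw [ofDigits_eq_head_add, div_le_iff₀ hb0, sub_mul, pow_succ, mul_inv, mul_assoc,
      inv_mul_cancel₀ hb0.ne']
    have h2 : ((a 0 : ℕ) : ℝ) + 1 ≤ b := by exact_mod_cast (a 0).isLt
    linarith

/-- A digit of `x` below `b - 1` soon after `j` rules out the near-coincidence of a tail of digits
`b - 1` with a carry. -/
theorem inv_pow_le_ofDigits_sub_ofDigits {x y : ℕ → Fin b} {j r : ℕ} (hxy : ∀ i < j, x i = y i)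
    (hlt : x j < y j) (hr : (x (j + 1 + r) : ℕ) + 1 < b) :
    ((b : ℝ) ^ (j + 1 + (r + 1)))⁻¹ ≤ Real.ofDigits y - Real.ofDigits x := by
  have hb0 : (0 : ℝ) < b := by exact_mod_cast Fin.pos (x 0)
  have hsum : ∑ i ∈ Finset.range j, Real.ofDigitsTerm x i =
      ∑ i ∈ Finset.range j, Real.ofDigitsTerm y i :=
    Finset.sum_congr rfl fun i hi => by
      simp [Real.ofDigitsTerm, hxy i (Finset.mem_range.mp hi)]
  rw [Real.ofDigits_eq_sum_add_ofDigits x (j + 1), Real.ofDigits_eq_sum_add_ofDigits y (j + 1),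
    Finset.sum_range_succ, Finset.sum_range_succ, hsum]
  have h1 := ofDigits_le_one_sub_inv_pow (fun i => x (i + (j + 1))) (r := r)
    (by rw [add_comm r]; exact hr)
  have h2 := Real.ofDigits_nonneg fun i => y (i + (j + 1))
  have h3 : ((x j : ℕ) : ℝ) + 1 ≤ (y j : ℕ) := by exact_mod_cast hlt
  have h4 : (0 : ℝ) < ((b : ℝ) ^ (j + 1))⁻¹ := by positivity
  rw [pow_add _ (j + 1), mul_inv]
  simp only [Real.ofDigitsTerm]
  nlinarith

theorem distNearestInt_pow_mul_ofDigits (a : ℕ → Fin b) (n : ℕ) :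
    distNearestInt ((b : ℝ) ^ n * Real.ofDigits a) =
      distNearestInt (Real.ofDigits fun i => a (i + n)) := by
  have hb0 : (b : ℝ) ≠ 0 := by exact_mod_cast (Fin.pos (a 0)).ne'
  obtain ⟨z, hz⟩ : ∃ z : ℤ,
      (z : ℝ) = (b : ℝ) ^ n * ∑ i ∈ Finset.range n, Real.ofDigitsTerm a i := by
    refine ⟨∑ i ∈ Finset.range n, ((a i : ℕ) : ℤ) * (b : ℤ) ^ (n - (i + 1)), ?_⟩
    push_cast
    rw [Finset.mul_sum]
    refine Finset.sum_congr rfl fun i hi => ?_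
    have hin : i + 1 ≤ n := Finset.mem_range.mp hi
    rw [Real.ofDigitsTerm, pow_sub₀ _ hb0 hin]
    ring
  rw [Real.ofDigits_eq_sum_add_ofDigits a n, mul_add, ← hz, mul_inv_cancel_left₀ (pow_ne_zero n hb0),
    add_comm, distNearestInt_add_intCast]

/-- After the shift by `n`, a nonzero digit keeps the number away from 0 and a digit below `b - 1`
keeps it away from 1. -/
theorem inv_pow_le_distNearestInt {a : ℕ → Fin b} {n r s L : ℕ} (hr : 1 ≤ (a (n + r) : ℕ))
    (hrL : r < L) (hs : (a (n + s) : ℕ) + 1 < b) (hsL : s < L) :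
    ((b : ℝ) ^ L)⁻¹ ≤ distNearestInt ((b : ℝ) ^ n * Real.ofDigits a) := by
  have hb1 : (1 : ℝ) ≤ b := by exact_mod_cast (Fin.pos (a 0))
  have hmono : ∀ {t}, t < L → ((b : ℝ) ^ L)⁻¹ ≤ ((b : ℝ) ^ (t + 1))⁻¹ := fun ht => by
    gcongr
    exact ht
  have h1 := (hmono hrL).trans (inv_pow_le_ofDigits (fun i => a (i + n)) (by rwa [add_comm r]))
  have h2 := ofDigits_le_one_sub_inv_pow (fun i => a (i + n)) (r := s) (by rwa [add_comm s])
  have h3 := hmono hsL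
  have hpos : (0 : ℝ) < ((b : ℝ) ^ L)⁻¹ := by positivity
  have hpos' : (0 : ℝ) < ((b : ℝ) ^ (s + 1))⁻¹ := by positivity
  rw [distNearestInt_pow_mul_ofDigits, distNearestInt, abs_sub_round_eq_min,
    Int.fract_eq_self.mpr ⟨by linarith, by linarith⟩]
  exact le_min h1 (by linarith)

theorem distNearestInt_le_inv_pow {a : ℕ → Fin b} {n L : ℕ} (h : ∀ i < L, (a (n + i) : ℕ) = 0) :
    distNearestInt ((b : ℝ) ^ n * Real.ofDigits a) ≤ ((b : ℝ) ^ L)⁻¹ := by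
  rw [distNearestInt_pow_mul_ofDigits]
  refine (distNearestInt_le _ 0).trans ?_
  rw [Int.cast_zero, sub_zero, abs_of_nonneg (Real.ofDigits_nonneg _),
    Real.ofDigits_eq_sum_add_ofDigits _ L, Finset.sum_eq_zero, zero_add]
  · exact mul_le_of_le_one_right (by positivity) (Real.ofDigits_le_one _)
  · intro i hi
    rw [Real.ofDigitsTerm, add_comm i n, h i (Finset.mem_range.mp hi), Nat.cast_zero, zero_mul]

/-- The sequence of digits that reads `d` in the positions satisfying `F`, and agrees with `c`
in the other positions. -/
def insertDigits (F : ℕ → Prop) [DecidablePred F] (c d : ℕ → Fin b) (j : ℕ) : Fin b :=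
  if F j then d (Nat.count F j) else c j

variable {F : ℕ → Prop} [DecidablePred F] {c : ℕ → Fin b}

theorem eq_of_insertDigits_eq {d d' : ℕ → Fin b} {j : ℕ}
    (h : ∀ i < j, insertDigits F c d i = insertDigits F c d' i) :
    ∀ i < Nat.count F j, d i = d' i := by
  induction j with
  | zero => intro i hi; simp at hi
  | succ j ih =>
    intro i hi
    rw [Nat.count_succ] at hi
    rcases lt_or_ge i (Nat.count F j) with h1 | h1
    · exact ih (fun k hk => h k (by omega)) i h1
    · have hF : F j := by
        by_contra hF
        rw [if_neg hF] at hi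
        omega
      rw [if_pos hF] at hi
      have h2 := h j (by omega)
      rw [insertDigits, insertDigits, if_pos hF, if_pos hF] at h2
      rwa [show i = Nat.count F j by omega]

/-- If the composed sequences first differ at `j`, then `d` and `d'` share their first `Nat.count F
j ≥ s * j - C` digits, whereas the composed numbers are at least `b ^ (-(j + 1 + h))` apart. -/
theorem abs_ofDigits_sub_le_mul_rpow (hb : 2 ≤ b) {s C : ℝ} {h : ℕ} (hs : 0 < s)
    (hcount : ∀ j : ℕ, s * j - C ≤ Nat.count F j)
    (hc : ∀ j, ∃ r < h, ¬ F (j + r) ∧ (c (j + r) : ℕ) + 1 < b) (d d' : ℕ → Fin b) :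
    |Real.ofDigits d - Real.ofDigits d'| ≤ (b : ℝ) ^ (C + s * (1 + h)) *
      |Real.ofDigits (insertDigits F c d) - Real.ofDigits (insertDigits F c d')| ^ s := by
  have hb1 : (1 : ℝ) < b := by exact_mod_cast (by omega : 1 < b)
  have hb0 : (0 : ℝ) < b := by linarith
  have hle : ∀ j : ℕ, (∀ i < j, insertDigits F c d i = insertDigits F c d' i) →
      |Real.ofDigits d - Real.ofDigits d'| ≤ (b : ℝ) ^ C * (b : ℝ) ^ (-(s * j)) := fun j hj => by
    refine (Real.abs_ofDigits_sub_ofDigits_le (eq_of_insertDigits_eq hj)).trans ?_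
    rw [← Real.rpow_natCast, ← Real.rpow_neg hb0.le, ← Real.rpow_add hb0]
    exact Real.rpow_le_rpow_of_exponent_le hb1.le (by linarith [hcount j])
  by_cases heq : insertDigits F c d = insertDigits F c d'
  · have hlim := (tendsto_rpow_neg_mul_atTop hb hs).const_mul ((b : ℝ) ^ C)
    rw [mul_zero] at hlim
    refine (ge_of_tendsto' hlim fun j => hle j fun i _ => by rw [heq]).trans (by positivity)
  · have hex : ∃ j, insertDigits F c d j ≠ insertDigits F c d' j := Function.ne_iff.mp heq
    classical
    let j := Nat.find hex
    have hj : insertDigits F c d j ≠ insertDigits F c d' j := Nat.find_spec hex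
    have hjlt : ∀ i < j, insertDigits F c d i = insertDigits F c d' i := fun i hi =>
      not_not.mp (Nat.find_min hex hi)
    obtain ⟨r, hrh, hrF, hrc⟩ := hc (j + 1)
    have hdig : ∀ e : ℕ → Fin b, (insertDigits F c e (j + 1 + r) : ℕ) + 1 < b := fun e => by
      rwa [insertDigits, if_neg hrF]
    have hsep : ((b : ℝ) ^ (j + 1 + (r + 1)))⁻¹ ≤
        |Real.ofDigits (insertDigits F c d) - Real.ofDigits (insertDigits F c d')| := by
      rcases hj.lt_or_gt with hlt | hlt
      · rw [abs_sub_comm]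
        exact (inv_pow_le_ofDigits_sub_ofDigits hjlt hlt (hdig d)).trans (le_abs_self _)
      · exact (inv_pow_le_ofDigits_sub_ofDigits (fun i hi => (hjlt i hi).symm) hlt
          (hdig d')).trans (le_abs_self _)
    refine (hle j hjlt).trans ?_
    calc (b : ℝ) ^ C * (b : ℝ) ^ (-(s * j))
        = (b : ℝ) ^ (C + s * (1 + h)) * ((b : ℝ) ^ (-((j : ℝ) + 1 + h))) ^ s := by
          rw [← Real.rpow_mul hb0.le, ← Real.rpow_add hb0, ← Real.rpow_add hb0]
          congr 1
          ring
      _ ≤ _ := by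
          gcongr
          refine le_trans ?_ hsep
          rw [← Real.rpow_natCast, ← Real.rpow_neg hb0.le]
          refine Real.rpow_le_rpow_of_exponent_le hb1.le (neg_le_neg ?_)
          push_cast
          have : (r : ℝ) + 1 ≤ h := by exact_mod_cast hrh
          linarith

theorem ofReal_le_dimH_range_ofDigits_insertDigits (hb : 2 ≤ b) {s C : ℝ} {h : ℕ} (hs : 0 < s)
    (hcount : ∀ j : ℕ, s * j - C ≤ Nat.count F j)
    (hc : ∀ j, ∃ r < h, ¬ F (j + r) ∧ (c (j + r) : ℕ) + 1 < b) :
    ENNReal.ofReal s ≤ dimH (range fun d => Real.ofDigits (insertDigits F c d)) := by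
  have key := abs_ofDigits_sub_le_mul_rpow hb hs hcount hc
  set K := range fun d => Real.ofDigits (insertDigits F c d) with hK
  -- Any choice of preimage serves: by `key`, two preimages of the same point represent the same
  -- real number.
  have hch : ∀ x : ℝ, ∃ d : ℕ → Fin b, x ∈ K → Real.ofDigits (insertDigits F c d) = x := fun x => by
    by_cases hx : x ∈ K
    · obtain ⟨d, hd⟩ := hx
      exact ⟨d, fun _ => hd⟩
    · exact ⟨fun _ => ⟨0, by omega⟩, fun h => absurd h hx⟩
  choose g hg using hch
  have hhol : HolderOnWith ((b : ℝ) ^ (C + s * (1 + h))).toNNReal s.toNNReal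
      (fun x => Real.ofDigits (g x)) K := by
    intro x hx y hy
    have := key (g x) (g y)
    rw [hg x hx, hg y hy] at this
    rw [edist_dist, edist_dist, Real.dist_eq, Real.dist_eq, Real.coe_toNNReal s hs.le,
      ENNReal.ofReal_rpow_of_nonneg (abs_nonneg _) hs.le]
    change _ ≤ ENNReal.ofReal _ * _
    rw [← ENNReal.ofReal_mul (by positivity)]
    exact ENNReal.ofReal_le_ofReal this
  have hsub : Icc (0 : ℝ) 1 ⊆ (fun x => Real.ofDigits (g x)) '' K := by
    intro y hy
    obtain ⟨d, -, rfl⟩ := Real.ofDigits_SurjOn (b := b) (by omega) hy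
    have hx : Real.ofDigits (insertDigits F c d) ∈ K := ⟨d, rfl⟩
    refine ⟨_, hx, ?_⟩
    have := key (g (Real.ofDigits (insertDigits F c d))) d
    rw [hg _ hx, sub_self, abs_zero, Real.zero_rpow hs.ne', mul_zero] at this
    exact sub_eq_zero.mp (abs_nonpos_iff.mp this)
  have h1 : dimH (Icc (0 : ℝ) 1) = 1 := by
    rw [Real.dimH_of_nonempty_interior (by rw [interior_Icc]; exact nonempty_Ioo.mpr one_pos)]
    simp
  have h2 := (h1.ge.trans (dimH_mono hsub)).trans
    (hhol.dimH_image_le (Real.toNNReal_pos.mpr hs))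
  have hs0 : ENNReal.ofReal s ≠ 0 := (ENNReal.ofReal_pos.mpr hs).ne'
  have h3 := (ENNReal.le_div_iff_mul_le (Or.inl hs0) (Or.inl ENNReal.ofReal_ne_top)).mp h2
  rwa [one_mul] at h3

end Digits

/-! ### Sequences with prescribed blocks of zeros -/

/-- The position at which the `k`-th block of zeros starts. -/
noncomputable def blockStart (A θ : ℝ) (k : ℕ) : ℕ := ⌊A * θ ^ k⌋₊

/-- The position following the `k`-th block of zeros. -/
noncomputable def blockEnd (A θ v : ℝ) (k : ℕ) : ℕ :=
  blockStart A θ k + ⌊v * blockStart A θ k⌋₊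

/-- The position `j` lies in one of the blocks of zeros. -/
def InBlock (A θ v : ℝ) (j : ℕ) : Prop := ∃ k, blockStart A θ k ≤ j ∧ j < blockEnd A θ v k

theorem exists_lt_add_mod_eq {h c : ℕ} (hc : c < h) (n : ℕ) : ∃ r < h, (n + r) % h = c := by
  have hn : n % h < h := Nat.mod_lt _ (by omega)
  have hdm := Nat.div_add_mod n h
  rcases le_or_gt (n % h) c with hle | hgt
  · refine ⟨c - n % h, by omega, ?_⟩
    rw [show n + (c - n % h) = c + h * (n / h) by omega, Nat.add_mul_mod_self_left,
      Nat.mod_eq_of_lt hc]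
  · refine ⟨c + h - n % h, by omega, ?_⟩
    rw [show n + (c + h - n % h) = c + h + h * (n / h) by omega, Nat.add_mul_mod_self_left,
      Nat.add_mod_right, Nat.mod_eq_of_lt hc]

section Blocks

variable {A θ v : ℝ} {h : ℕ}

theorem blockStart_le (hA : 1 ≤ A) (hθ : 1 < θ) (k : ℕ) : (blockStart A θ k : ℝ) ≤ A * θ ^ k :=
  Nat.floor_le (by positivity)

theorem lt_blockStart_add_one (A θ : ℝ) (k : ℕ) : A * θ ^ k < blockStart A θ k + 1 :=
  Nat.lt_floor_add_one _

theorem blockStart_le_blockEnd (k : ℕ) : blockStart A θ k ≤ blockEnd A θ v k := Nat.le_add_right _ _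

theorem blockEnd_le (hv : 0 < v) (k : ℕ) :
    (blockEnd A θ v k : ℝ) ≤ (1 + v) * blockStart A θ k := by
  have := Nat.floor_le (mul_nonneg hv.le (Nat.cast_nonneg (α := ℝ) (blockStart A θ k)))
  rw [blockEnd]
  push_cast
  linarith

theorem blockEnd_add_lt_blockStart_succ (hA : 1 ≤ A) (hθ : 1 < θ) (hv : 0 < v)
    (hgap : h + 1 ≤ A * (θ - 1 - v)) (k : ℕ) :
    blockEnd A θ v k + h < blockStart A θ (k + 1) := by
  have h1 := blockEnd_le (A := A) (θ := θ) hv k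
  have h2 := blockStart_le hA hθ k
  have h3 := lt_blockStart_add_one A θ (k + 1)
  have h4 : (h : ℝ) + 1 ≤ A * (θ - 1 - v) * θ ^ k :=
    hgap.trans (le_mul_of_one_le_right (by linarith [Nat.cast_nonneg (α := ℝ) h])
      (one_le_pow₀ hθ.le))
  have h5 : (1 + v) * blockStart A θ k ≤ (1 + v) * (A * θ ^ k) := by gcongr
  rw [pow_succ] at h3
  have h6 : ((blockEnd A θ v k + h : ℕ) : ℝ) < blockStart A θ (k + 1) := by
    push_cast
    nlinarith
  exact_mod_cast h6

theorem strictMono_blockStart (hA : 1 ≤ A) (hθ : 1 < θ) (hv : 0 < v)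
    (hgap : h + 1 ≤ A * (θ - 1 - v)) : StrictMono (blockStart A θ) :=
  strictMono_nat_of_lt_succ fun k => by
    have h1 := blockEnd_add_lt_blockStart_succ hA hθ hv hgap k
    have h2 := blockStart_le_blockEnd (A := A) (θ := θ) (v := v) k
    omega

theorem not_inBlock_of_mem_gap (hmono : StrictMono (blockStart A θ)) {k n : ℕ}
    (hend : ∀ i < k, blockEnd A θ v i ≤ n) {j : ℕ} (hnj : n ≤ j) (hjk : j < blockStart A θ k) :
    ¬ InBlock A θ v j := by
  rintro ⟨i, hi1, hi2⟩
  rcases lt_or_ge i k with hik | hik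
  · have := hend i hik
    omega
  · have := hmono.monotone hik
    omega

theorem blockEnd_le_blockStart_of_lt (hA : 1 ≤ A) (hθ : 1 < θ) (hv : 0 < v)
    (hgap : h + 1 ≤ A * (θ - 1 - v)) {i k : ℕ} (hik : i < k) :
    blockEnd A θ v i ≤ blockStart A θ k := by
  have h1 := blockEnd_add_lt_blockStart_succ hA hθ hv hgap i
  have h2 := (strictMono_blockStart hA hθ hv hgap).monotone (Nat.succ_le_of_lt hik)
  rw [Nat.succ_eq_add_one] at h2
  omega

theorem not_inBlock_after_blockEnd (hA : 1 ≤ A) (hθ : 1 < θ) (hv : 0 < v)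
    (hgap : h + 1 ≤ A * (θ - 1 - v)) {k j : ℕ} (h1 : blockEnd A θ v k ≤ j)
    (h2 : j < blockStart A θ (k + 1)) : ¬ InBlock A θ v j := by
  refine not_inBlock_of_mem_gap (strictMono_blockStart hA hθ hv hgap) (fun i hi => ?_) h1 h2
  rcases (Nat.lt_succ_iff.mp hi).lt_or_eq with hik | rfl
  · exact (blockEnd_le_blockStart_of_lt hA hθ hv hgap hik).trans (blockStart_le_blockEnd k)
  · exact le_rfl

section Orbit

variable {b : ℕ} {a : ℕ → Fin b}

/-- Let `k` be the first block ending after `n`. If it starts at `n + h` or later, the window of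
length `h` holds both markers. Otherwise a marker 1 occurs within `h` after its end, at offset less
than the block length plus `2 * h` from `n`. -/
theorem inv_pow_le_orbitDist_of_blocks (hb : 2 ≤ b) (hA : 1 ≤ A) (hθ : 1 < θ) (hv : 0 < v)
    (hh : 2 ≤ h) (hgap : h + 1 ≤ A * (θ - 1 - v)) (ha0 : ∀ j, j % h = 0 → (a j : ℕ) = 0)
    (ha1 : ∀ j, j % h = 1 → ¬ InBlock A θ v j → (a j : ℕ) = 1) (n : ℕ) :
    ((b : ℝ) ^ h)⁻¹ ≤ orbitDist b (Real.ofDigits a) n ∨ ∃ k, blockStart A θ k ≤ n + h ∧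
      ((b : ℝ) ^ (⌊v * blockStart A θ k⌋₊ + 2 * h))⁻¹ ≤ orbitDist b (Real.ofDigits a) n := by
  have hmono := strictMono_blockStart hA hθ hv hgap
  have hex : ∃ k, n < blockEnd A θ v k :=
    ⟨n + 1, (Nat.lt_succ_self n).trans_le ((hmono.le_apply).trans (blockStart_le_blockEnd _))⟩
  classical
  let k := Nat.find hex
  have hk : n < blockEnd A θ v k := Nat.find_spec hex
  have hkmin : ∀ i < k, blockEnd A θ v i ≤ n := fun i hi => not_lt.mp (Nat.find_min hex hi)
  obtain ⟨s, hs, hs0⟩ := exists_lt_add_mod_eq (by omega : 0 < h) n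
  have has : (a (n + s) : ℕ) + 1 < b := by rw [ha0 _ hs0]; omega
  rcases le_or_gt (n + h) (blockStart A θ k) with hle | hgt
  · left
    obtain ⟨r, hr, hr1⟩ := exists_lt_add_mod_eq (by omega : 1 < h) n
    have har := ha1 _ hr1 (not_inBlock_of_mem_gap hmono hkmin (by omega) (by omega))
    exact inv_pow_le_distNearestInt har.ge hr has hs
  · right
    refine ⟨k, hgt.le, ?_⟩
    obtain ⟨r, hr, hr1⟩ := exists_lt_add_mod_eq (by omega : 1 < h) (blockEnd A θ v k)
    have hlt := blockEnd_add_lt_blockStart_succ hA hθ hv hgap k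
    have har := ha1 _ hr1 (not_inBlock_after_blockEnd hA hθ hv hgap (k := k) (by omega) (by omega))
    have hbe : blockEnd A θ v k = blockStart A θ k + ⌊v * blockStart A θ k⌋₊ := rfl
    rw [show blockEnd A θ v k + r = n + (blockEnd A θ v k + r - n) by omega] at har
    exact inv_pow_le_distNearestInt har.ge (by omega) has (by omega)

theorem orbitDist_blockStart_le (ha : ∀ j, InBlock A θ v j → (a j : ℕ) = 0) (k : ℕ) :
    orbitDist b (Real.ofDigits a) (blockStart A θ k) ≤
      ((b : ℝ) ^ ⌊v * blockStart A θ k⌋₊)⁻¹ :=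
  distNearestInt_le_inv_pow fun i hi => ha _ ⟨k, by omega, by rw [blockEnd]; omega⟩

theorem expV_ofDigits_of_blocks (hb : 2 ≤ b) (hA : 1 ≤ A) (hθ : 1 < θ) (hv : 0 < v)
    (hh : 2 ≤ h) (hgap : h + 1 ≤ A * (θ - 1 - v)) (ha0 : ∀ j, j % h = 0 → (a j : ℕ) = 0)
    (ha1 : ∀ j, j % h = 1 → ¬ InBlock A θ v j → (a j : ℕ) = 1)
    (ha : ∀ j, InBlock A θ v j → (a j : ℕ) = 0) : expV b (Real.ofDigits a) = v := by
  have hb1 : (1 : ℝ) < b := by exact_mod_cast (by omega : 1 < b)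
  have hmono := strictMono_blockStart hA hθ hv hgap
  refine le_antisymm (expV_le_of_forall_eventually hb fun w hw => ?_)
    (le_expV_of_forall_infinite fun w hw => infinite_of_forall_exists_gt fun B => ?_)
  · have hwv : 0 < w - v := by linarith
    obtain ⟨n₀, hn₀⟩ := exists_nat_ge ((v * h + 2 * h) / (w - v))
    refine ⟨n₀, fun n hn => ?_⟩
    have hn' : (n₀ : ℝ) ≤ n := by exact_mod_cast hn
    have h1 : v * h + 2 * h ≤ n * (w - v) := (div_le_iff₀ hwv).mp (hn₀.trans hn')
    have hvn : 0 ≤ v * n := by positivity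
    have hvh : 0 ≤ v * h := by positivity
    rcases inv_pow_le_orbitDist_of_blocks hb hA hθ hv hh hgap ha0 ha1 n with h2 | ⟨k, hk, h2⟩
    · refine le_trans ?_ h2
      rw [← Real.rpow_natCast, ← Real.rpow_neg (by positivity)]
      refine Real.rpow_le_rpow_of_exponent_le hb1.le (neg_le_neg ?_)
      linarith [Nat.cast_nonneg (α := ℝ) h]
    · refine le_trans ?_ h2
      rw [← Real.rpow_natCast, ← Real.rpow_neg (by positivity)]
      refine Real.rpow_le_rpow_of_exponent_le hb1.le (neg_le_neg ?_)
      push_cast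
      have h3 := Nat.floor_le (mul_nonneg hv.le (Nat.cast_nonneg (α := ℝ) (blockStart A θ k)))
      have h4 : v * blockStart A θ k ≤ v * (n + h) := by
        gcongr
        exact_mod_cast hk
      linarith
  · have hwv : 0 < v - w := by linarith
    obtain ⟨K, hK⟩ := exists_nat_ge (1 / (v - w))
    have hle : B + K + 1 ≤ blockStart A θ (B + K + 1) := hmono.le_apply
    refine ⟨blockStart A θ (B + K + 1), ⟨by omega, ?_⟩, by omega⟩
    refine (orbitDist_blockStart_le ha _).trans_lt ?_
    rw [← Real.rpow_natCast, ← Real.rpow_neg (by positivity)]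
    refine Real.rpow_lt_rpow_of_exponent_lt hb1 (neg_lt_neg ?_)
    have h1 := Nat.lt_floor_add_one (v * blockStart A θ (B + K + 1))
    have h2 : (K : ℝ) ≤ blockStart A θ (B + K + 1) := by exact_mod_cast (by omega)
    have h3 := (div_le_iff₀ hwv).mp (hK.trans h2)
    linarith

theorem expVHat_ofDigits_of_blocks {u : ℝ} (hb : 2 ≤ b) (hA : 1 ≤ A) (hθ : 1 < θ) (hu : 0 < u)
    (hvu : v = θ * u) (hh : 2 ≤ h) (hgap : h + 1 ≤ A * (θ - 1 - v))
    (ha0 : ∀ j, j % h = 0 → (a j : ℕ) = 0)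
    (ha1 : ∀ j, j % h = 1 → ¬ InBlock A θ v j → (a j : ℕ) = 1)
    (ha : ∀ j, InBlock A θ v j → (a j : ℕ) = 0) : expVHat b (Real.ofDigits a) = u := by
  have hv : 0 < v := by rw [hvu]; positivity
  have hb1 : (1 : ℝ) < b := by exact_mod_cast (by omega : 1 < b)
  have hmono := strictMono_blockStart hA hθ hv hgap
  refine le_antisymm (expVHat_le_of_forall_frequently hb fun w hw N₀ => ?_)
    (le_expVHat_of_forall_eventually fun w hw => ?_)
  · have hwu : 0 < w - u := by linarith
    obtain ⟨K, hK⟩ := exists_nat_ge ((u * (h + 2) + 2 * h) / (w - u))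
    set k := h + K + N₀ with hk
    have hle : k + 1 ≤ blockStart A θ (k + 1) := hmono.le_apply
    -- For `n` up to this `N`, `n + h` stays below the start of block `k + 1`, so only blocks up to
    -- `k` matter; their exponent is at most `v * A * θ ^ k = u * A * θ ^ (k + 1)`, about `u * N`.
    refine ⟨blockStart A θ (k + 1) - (h + 1), by omega, fun n _ hn => ?_⟩
    set N := blockStart A θ (k + 1) - (h + 1) with hN
    have hNeq : (blockStart A θ (k + 1) : ℝ) = N + h + 1 := by
      exact_mod_cast (by omega : blockStart A θ (k + 1) = N + h + 1)
    have hKN : (K : ℝ) ≤ N := by exact_mod_cast (by omega : K ≤ N)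
    have h1 : u * (h + 2) + 2 * h ≤ N * (w - u) := (div_le_iff₀ hwu).mp (hK.trans hKN)
    have huN : 0 ≤ u * N := by positivity
    have huh : 0 ≤ u * (h + 2) := by positivity
    rcases inv_pow_le_orbitDist_of_blocks hb hA hθ hv hh hgap ha0 ha1 n with h2 | ⟨i, hi, h2⟩
    · refine le_trans ?_ h2
      rw [← Real.rpow_natCast, ← Real.rpow_neg (by positivity)]
      refine Real.rpow_le_rpow_of_exponent_le hb1.le (neg_le_neg ?_)
      linarith [Nat.cast_nonneg (α := ℝ) h]
    · refine le_trans ?_ h2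
      rw [← Real.rpow_natCast, ← Real.rpow_neg (by positivity)]
      refine Real.rpow_le_rpow_of_exponent_le hb1.le (neg_le_neg ?_)
      push_cast
      have hik : i < k + 1 := hmono.lt_iff_lt.mp (by omega)
      have h3 := Nat.floor_le (mul_nonneg hv.le (Nat.cast_nonneg (α := ℝ) (blockStart A θ i)))
      have h4 : v * blockStart A θ i ≤ v * (A * θ ^ k) := by
        gcongr
        refine le_trans ?_ (blockStart_le hA hθ k)
        exact_mod_cast hmono.monotone (Nat.lt_succ_iff.mp hik)
      have h5 : v * (A * θ ^ k) = u * (A * θ ^ (k + 1)) := by rw [hvu]; ring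
      have h6 : u * (A * θ ^ (k + 1)) ≤ u * (N + h + 2) := by
        gcongr
        linarith [lt_blockStart_add_one A θ (k + 1)]
      linarith
  · have hwu : 0 < u - w := by linarith
    obtain ⟨N₀, hN₀⟩ := exists_nat_ge ((v + 1) / (u - w))
    refine ⟨N₀ + blockStart A θ 0, fun N hN => ?_⟩
    have hex : ∃ k, N < blockStart A θ k := ⟨N + 1, (Nat.lt_succ_self N).trans_le hmono.le_apply⟩
    classical
    obtain ⟨k, hk⟩ : ∃ k, Nat.find hex = k + 1 := Nat.exists_eq_succ_of_ne_zero fun h0 => by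
      have := Nat.find_spec hex
      rw [h0] at this
      omega
    have hk1 : N < blockStart A θ (k + 1) := hk ▸ Nat.find_spec hex
    have hk2 : blockStart A θ k ≤ N := not_lt.mp (Nat.find_min hex (by omega))
    have hpos : 1 ≤ blockStart A θ k :=
      Nat.le_floor (by rw [Nat.cast_one]; exact one_le_mul_of_one_le_of_one_le hA (one_le_pow₀ hθ.le))
    -- The start of the last block begun by time `N` works up to the next start, because `v = θ *
    -- u`.
    refine ⟨blockStart A θ k, hpos, hk2, (orbitDist_blockStart_le ha k).trans_lt ?_⟩
    rw [← Real.rpow_natCast, ← Real.rpow_neg (by positivity)]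
    refine Real.rpow_lt_rpow_of_exponent_lt hb1 (neg_lt_neg ?_)
    have h1 := Nat.lt_floor_add_one (v * blockStart A θ k)
    have h2 : v * (A * θ ^ k) ≤ v * (blockStart A θ k + 1) := by
      gcongr
      exact (lt_blockStart_add_one A θ k).le
    have h3 : v * (A * θ ^ k) = u * (A * θ ^ (k + 1)) := by rw [hvu]; ring
    have h4 : u * N ≤ u * (A * θ ^ (k + 1)) := by
      gcongr
      refine le_trans ?_ (blockStart_le hA hθ (k + 1))
      exact_mod_cast hk1.le
    have h5 : (N₀ : ℝ) ≤ N := by exact_mod_cast (by omega : N₀ ≤ N)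
    have h6 := (div_le_iff₀ hwu).mp (hN₀.trans h5)
    linarith

end Orbit

/-! ### Density of the free positions -/

section Count

open scoped Classical in
theorem count_inBlock_le {σ : ℝ} (hA : 1 ≤ A) (hθ : 1 < θ) (hv : 0 < v)
    (hgap : h + 1 ≤ A * (θ - 1 - v)) (hσ0 : 0 ≤ σ) (hσ : σ * (1 + v) ≤ 1 - v / (θ - 1)) (j : ℕ) :
    (Nat.count (InBlock A θ v) j : ℝ) ≤ (1 - σ) * j + 1 := by
  have hmono := strictMono_blockStart hA hθ hv hgap
  have hθ1 : 0 < θ - 1 := by linarith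
  have hσ1 : σ ≤ 1 := by nlinarith [div_pos hv hθ1]
  have hstep : ∀ {m n : ℕ}, m ≤ n → Nat.count (InBlock A θ v) n ≤
      Nat.count (InBlock A θ v) m + (n - m) := fun {m n} hmn => by
    obtain ⟨c, rfl⟩ := Nat.exists_eq_add_of_le hmn
    rw [Nat.count_add, Nat.add_sub_cancel_left]
    exact Nat.add_le_add_left (Nat.count_le _) _
  have hzero : ∀ k {n : ℕ}, blockEnd A θ v k ≤ n → n ≤ blockStart A θ (k + 1) →
      Nat.count (InBlock A θ v) n = Nat.count (InBlock A θ v) (blockEnd A θ v k) :=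
    fun k {n} h1 h2 => by
      obtain ⟨c, rfl⟩ := Nat.exists_eq_add_of_le h1
      rw [Nat.count_add, Nat.add_eq_left, Nat.count_iff_forall_not]
      intro i hi
      exact not_inBlock_after_blockEnd hA hθ hv hgap (k := k) (by omega) (by omega)
  -- The block lengths before start `k` sum geometrically to at most `v / (θ - 1) * (A * θ ^ k)`.
  -- The proportion of block positions peaks at block ends, near `(1 + v) * (A * θ ^ k)`, which is
  -- where `hσ` is needed.
  have main : ∀ k, (Nat.count (InBlock A θ v) (blockStart A θ k) : ℝ) ≤ v / (θ - 1) * (A * θ ^ k) ∧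
      ∀ j ≤ blockStart A θ k, (Nat.count (InBlock A θ v) j : ℝ) ≤ (1 - σ) * j + 1 := by
    intro k
    induction k with
    | zero =>
      have h0 : ∀ j ≤ blockStart A θ 0, Nat.count (InBlock A θ v) j = 0 := fun j hj => by
        rw [Nat.count_iff_forall_not]
        intro i hi
        exact not_inBlock_of_mem_gap hmono (k := 0) (n := 0) (by omega) (by omega) (by omega)
      refine ⟨?_, fun j hj => ?_⟩
      · rw [h0 _ le_rfl, Nat.cast_zero]
        positivity
      · rw [h0 j hj, Nat.cast_zero]
        have : 0 ≤ (1 - σ) * j := mul_nonneg (by linarith) (Nat.cast_nonneg _)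
        linarith
    | succ k ih =>
      have hend := blockEnd_add_lt_blockStart_succ hA hθ hv hgap k
      have hse := blockStart_le_blockEnd (A := A) (θ := θ) (v := v) k
      have hmid : ∀ j, blockStart A θ k ≤ j → j ≤ blockEnd A θ v k →
          (Nat.count (InBlock A θ v) j : ℝ) ≤ (1 - σ) * j + 1 := fun j h1 h2 => by
        have h3 : (Nat.count (InBlock A θ v) j : ℝ) ≤
            Nat.count (InBlock A θ v) (blockStart A θ k) + (j - blockStart A θ k) := by
          rw [← Nat.cast_sub h1]
          exact_mod_cast hstep h1
        have h4 : (j : ℝ) ≤ (1 + v) * (A * θ ^ k) := by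
          calc (j : ℝ) ≤ blockEnd A θ v k := by exact_mod_cast h2
            _ ≤ (1 + v) * blockStart A θ k := blockEnd_le hv k
            _ ≤ (1 + v) * (A * θ ^ k) := by
              gcongr
              exact blockStart_le hA hθ k
        have h5 : σ * j ≤ (1 - v / (θ - 1)) * (A * θ ^ k) := by
          calc σ * j ≤ σ * ((1 + v) * (A * θ ^ k)) := by gcongr
            _ = σ * (1 + v) * (A * θ ^ k) := by ring
            _ ≤ _ := by gcongr
        linarith [ih.1, lt_blockStart_add_one A θ k]
      have hcountEnd : (Nat.count (InBlock A θ v) (blockEnd A θ v k) : ℝ) ≤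
          v / (θ - 1) * (A * θ ^ (k + 1)) := by
        have h1 : (Nat.count (InBlock A θ v) (blockEnd A θ v k) : ℝ) ≤
            Nat.count (InBlock A θ v) (blockStart A θ k) +
              (blockEnd A θ v k - blockStart A θ k) := by
          rw [← Nat.cast_sub hse]
          exact_mod_cast hstep hse
        have h2 := blockEnd_le (A := A) (θ := θ) hv k
        have h3 : v * blockStart A θ k ≤ v * (A * θ ^ k) := by
          gcongr
          exact blockStart_le hA hθ k
        have h4 : v / (θ - 1) * (A * θ ^ (k + 1)) =
            v / (θ - 1) * (A * θ ^ k) + v * (A * θ ^ k) := by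
          field_simp
          ring
        linarith [ih.1]
      refine ⟨by rwa [hzero k (by omega) le_rfl], fun j hj => ?_⟩
      rcases le_or_gt j (blockStart A θ k) with h1 | h1
      · exact ih.2 j h1
      rcases le_or_gt j (blockEnd A θ v k) with h2 | h2
      · exact hmid j h1.le h2
      · rw [hzero k h2.le hj]
        refine (hmid _ hse le_rfl).trans ?_
        have : (blockEnd A θ v k : ℝ) ≤ j := by exact_mod_cast h2.le
        have : 0 ≤ 1 - σ := by linarith
        gcongr
  exact (main j).2 j hmono.le_apply

theorem count_mod_eq_le (hh : 0 < h) (c j : ℕ) :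
    (Nat.count (fun i => i % h = c) j : ℝ) ≤ j / h + 1 := by
  by_cases hc : c < h
  · have h1 : Nat.count (fun i => i % h = c) j ≤ j / h + 1 := by
      have h2 := Nat.count_modEq_card j hh c
      simp only [Nat.ModEq, Nat.mod_eq_of_lt hc] at h2
      rw [h2]
      split_ifs <;> omega
    calc (Nat.count (fun i => i % h = c) j : ℝ) ≤ ((j / h + 1 : ℕ) : ℝ) := by exact_mod_cast h1
      _ ≤ j / h + 1 := by
        push_cast
        gcongr
        exact Nat.cast_div_le
  · have : Nat.count (fun i => i % h = c) j = 0 := by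
      rw [Nat.count_iff_forall_not]
      intro i _ hi
      exact hc (hi ▸ Nat.mod_lt _ hh)
    rw [this, Nat.cast_zero]
    positivity

open scoped Classical in
theorem le_count_not_inBlock_and_two_le_mod {σ : ℝ} (hA : 1 ≤ A) (hθ : 1 < θ) (hv : 0 < v)
    (hh : 0 < h) (hgap : h + 1 ≤ A * (θ - 1 - v)) (hσ0 : 0 ≤ σ)
    (hσ : σ * (1 + v) ≤ 1 - v / (θ - 1)) (j : ℕ) :
    (σ - 2 / h) * j - 3 ≤ Nat.count (fun i => ¬ InBlock A θ v i ∧ 2 ≤ i % h) j := by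
  have h1 : j ≤ Nat.count (fun i => ¬ InBlock A θ v i ∧ 2 ≤ i % h) j +
      Nat.count (InBlock A θ v) j + Nat.count (fun i => i % h = 0) j +
      Nat.count (fun i => i % h = 1) j := by
    induction j with
    | zero => simp
    | succ j ih =>
      simp only [Nat.count_succ]
      by_cases hB : InBlock A θ v j
      · simp only [hB, if_true]
        omega
      · simp only [hB, not_false_eq_true, true_and, if_false]
        split_ifs <;> omega
  have h2 : (j : ℝ) ≤ Nat.count (fun i => ¬ InBlock A θ v i ∧ 2 ≤ i % h) j +
      Nat.count (InBlock A θ v) j + Nat.count (fun i => i % h = 0) j +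
      Nat.count (fun i => i % h = 1) j := by exact_mod_cast h1
  have h3 := count_inBlock_le hA hθ hv hgap hσ0 hσ j
  have h4 := count_mod_eq_le hh 0 j
  have h5 := count_mod_eq_le hh 1 j
  have h6 : (2 : ℝ) / h * j = 2 * (j / h) := by ring
  linarith

end Count

end Blocks

/-! ### Lower bound and conclusion -/

theorem le_dimH_of_one_div_lt {b : ℕ} (hb : 2 ≤ b) {vhat θ : ℝ} (hv : 0 < vhat) (hv1 : vhat < 1)
    (hθ : 1 / (1 - vhat) < θ) :
    ENNReal.ofReal ((θ - 1 - θ * vhat) / ((1 + θ * vhat) * (θ - 1))) ≤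
      dimH ({ξ : ℝ | expVHat b ξ = (vhat : EReal)} ∩
        {ξ : ℝ | expV b ξ = ((θ * vhat : ℝ) : EReal)}) := by
  have h1v : 0 < 1 - vhat := by linarith
  have hθ' : 1 < θ * (1 - vhat) := (div_lt_iff₀ h1v).mp hθ
  have hθ1 : 1 < θ := by nlinarith
  have hθ10 : 0 < θ - 1 := by linarith
  set v := θ * vhat with hvdef
  have hv0 : 0 < v := by positivity
  have hgap0 : 0 < θ - 1 - v := by linarith
  set σ := (θ - 1 - v) / ((1 + v) * (θ - 1)) with hσdef
  have hσ0 : 0 < σ := by positivity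
  have hσ : σ * (1 + v) = 1 - v / (θ - 1) := by
    rw [hσdef]
    field_simp
  have hle : ∀ h : ℕ, 2 ≤ h → ENNReal.ofReal (σ - 2 / h) ≤
      dimH ({ξ : ℝ | expVHat b ξ = (vhat : EReal)} ∩ {ξ : ℝ | expV b ξ = (v : EReal)}) := by
    intro h hh
    rcases le_or_gt (σ - 2 / h) 0 with hneg | hpos
    · rw [ENNReal.ofReal_of_nonpos hneg]
      exact zero_le
    classical
    -- Large enough for consecutive blocks to be more than `h` apart; this is possible since `1 / (1
    -- - vhat) < θ` means `θ - 1 - v > 0`.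
    set A := max 1 ((h + 1) / (θ - 1 - v)) with hAdef
    have hA : 1 ≤ A := le_max_left _ _
    have hgap : h + 1 ≤ A * (θ - 1 - v) := (div_le_iff₀ hgap0).mp (le_max_right _ _)
    let F : ℕ → Prop := fun i => ¬ InBlock A θ v i ∧ 2 ≤ i % h
    let c : ℕ → Fin b := fun i =>
      if ¬ InBlock A θ v i ∧ i % h = 1 then ⟨1, by omega⟩ else ⟨0, by omega⟩
    refine (ofReal_le_dimH_range_ofDigits_insertDigits (F := F) (c := c) hb hpos (C := 3) (h := h)
      (le_count_not_inBlock_and_two_le_mod hA hθ1 hv0 (by omega) hgap hσ0.le hσ.le) ?_).trans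
      (dimH_mono ?_)
    · intro j
      obtain ⟨r, hr, hr0⟩ := exists_lt_add_mod_eq (by omega : 0 < h) j
      refine ⟨r, hr, fun hF => by have := hF.2; omega, ?_⟩
      simp only [c, hr0]
      simp
      omega
    · rintro _ ⟨d, rfl⟩
      have ha0 : ∀ j, j % h = 0 → (insertDigits F c d j : ℕ) = 0 := fun j hj => by
        simp [insertDigits, F, c, hj]
      have ha1 : ∀ j, j % h = 1 → ¬ InBlock A θ v j → (insertDigits F c d j : ℕ) = 1 :=
        fun j hj hB => by simp [insertDigits, F, c, hj, hB]
      have ha : ∀ j, InBlock A θ v j → (insertDigits F c d j : ℕ) = 0 := fun j hB => by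
        simp [insertDigits, F, c, hB]
      exact ⟨expVHat_ofDigits_of_blocks hb hA hθ1 hv hvdef hh hgap ha0 ha1 ha,
        expV_ofDigits_of_blocks hb hA hθ1 hv0 hh hgap ha0 ha1 ha⟩
  have hlim : Tendsto (fun h : ℕ => ENNReal.ofReal (σ - 2 / h)) atTop (𝓝 (ENNReal.ofReal σ)) := by
    refine ENNReal.tendsto_ofReal ?_
    simpa using (tendsto_const_div_atTop_nhds_zero_nat (2 : ℝ)).const_sub σ
  exact le_of_tendsto hlim ((eventually_ge_atTop 2).mono hle)

theorem theorem1p2 (b : ℕ) (hb : 2 ≤ b) :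
    (∀ θ vhat : ℝ, 0 < θ → 0 < vhat → vhat < 1 →
      (θ < 1 / (1 - vhat) →
        {ξ : ℝ | (vhat : EReal) ≤ expVHat b ξ} ∩
          {ξ : ℝ | expV b ξ = ((θ * vhat : ℝ) : EReal)} = ∅) ∧
      (1 / (1 - vhat) ≤ θ →
        dimH ({ξ : ℝ | expVHat b ξ = (vhat : EReal)} ∩
          {ξ : ℝ | expV b ξ = ((θ * vhat : ℝ) : EReal)}) =
        ENNReal.ofReal ((θ - 1 - θ * vhat) / ((1 + θ * vhat) * (θ - 1))))) ∧
    dimH {ξ : ℝ | expVHat b ξ = 1} = 0 := by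
  refine ⟨fun θ vhat _ hv hv1 => ⟨inter_eq_empty_of_lt hb hv hv1, fun hθ => ?_⟩, ?_⟩
  · refine le_antisymm (dimH_le_of_one_div_le hb hv hv1 hθ) ?_
    rcases hθ.lt_or_eq with hlt | heq
    · exact le_dimH_of_one_div_lt hb hv hv1 hlt
    -- At the endpoint the claimed dimension is 0, so the lower bound is trivial.
    · have h0 : θ - 1 - θ * vhat = 0 := by
        have : 1 - vhat ≠ 0 := by linarith
        rw [← heq]
        field_simp
        ring
      rw [h0, zero_div, ENNReal.ofReal_zero]
      exact zero_le
  · refine le_antisymm ((dimH_mono fun ξ hξ => ?_).trans (dimH_setOf_expV_eq_top hb).le) zero_le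
    have hξ : expVHat b ξ = 1 := hξ
    exact expV_eq_top_of_one_le_expVHat hb hξ.ge
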